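/- Let $D\ge 3$, let $U\subset\mathbb R^{D-2}$ be open, $\rho_0>0$, $G>0$, $\Lambda\in\mathbb R$, and use coordinates $(x^\mu)=(t,\rho,x^M)$, $M=2,\dots,D-1$, with $(x^M)=(\psi,\theta^A)$, $A=3,\dots,D-1$, on the domain $\mathcal M=\{t\in\mathbb R,\ 0\le\rho<\rho_0,\ (x^M)\in U\}$. The horizon is $\{\rho=0\}$ and $\partial\Sigma=\{t=\mathrm{const},\ \rho=0\}$. All components of fields below are smooth on $\mathcal M$ up to $\rho=0$, and $O(\rho^k)$ in an expansion of such fields means $\rho^k$ times a function smooth on $\mathcal M$. Let $\bar g$ be a symmetric tensor field on $\mathcal M$ which for $\rho>0$ is a Lorentzian metric satisfying the Einstein equations $R_{\mu\nu}-\frac12(R-2\Lambda)\bar g_{\mu\nu}=0$, with $$\bar g_{tt}=-\kappa^2\rho^2+O(\rho^4),\quad \bar g_{t\rho}=O(\rho^4),\quad \bar g_{t\psi}=f_{t\psi}\rho^2+O(\rho^4),\quad \bar g_{tA}=f_{tA}\rho^2+O(\rho^4),$$ $$\bar g_{\rho\rho}=1+O(\rho^2),\quad \bar g_{\rho\psi}=O(\rho^4),\quad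 \bar g_{\rho A}=O(\rho^3),\quad \bar g_{\psi\psi}=f_{\psi\psi}+O(\rho^2),\quad \bar g_{\psi A}=O(\rho^2),\quad \bar g_{AB}=\Omega_{AB}+O(\rho^2),$$ where $\kappa\neq0$ is constant and $f_{t\psi},f_{tA},f_{\psi\psi}>0$ and the positive definite matrix $\Omega_{AB}$ are smooth functions of $\theta^A$ only. Let $$\mathcal A=\{(T(x^M)+O(\rho^2),\ O(\rho^2),\ V^M(x^N)+O(\rho^2)) : T, V^M \text{ arbitrary smooth functions on } U\}.$$ For a metric $g$ and symmetric tensor fields $\delta_1g,\delta_2g$ let $$\omega^\nu(g,\delta_1g,\delta_2g)=\frac{\sqrt{-\det g}}{16\pi G}\Bigl(g^{\nu\alpha}(g^{\rho\sigma}g^{\beta\gamma}-2g^{\rho\beta}g^{\sigma\gamma})+2g^{\nu\gamma}g^{\rho[\alpha}g^{\sigma]\beta}+g^{\nu\rho}g^{\alpha\beta}g^{\sigma\gamma}\Bigr)\delta_{[1}g_{\rho\sigma}\nabla_\gamma\delta_{2]}g_{\alpha\beta}$$ be the pre-symplectic current ($\nabla$ is the Levi-Civita connection of $g$; brackets denote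 antisymmetrization with the factor $\frac12$). Then: 1. $\mathcal A$ is closed: it is a linear space of vector fields and is closed under commutators. More precisely, if $\xi,\eta\in\mathcal A$ have leading coefficients $(T_1,V_1)$ and $(T_2,V_2)$, then $[\xi,\eta]^t=V_1^M\partial_MT_2-V_2^M\partial_MT_1+O(\rho^2)$, $[\xi,\eta]^\rho=O(\rho^2)$ and $[\xi,\eta]^M=V_1^N\partial_NV_2^M-V_2^N\partial_NV_1^M+O(\rho^2)$. 2. $\mathcal A$ satisfies the sufficient condition for integrability: for all $\xi,\eta,\chi\in\mathcal A$, as $\rho\to0^+$ and locally uniformly near each point of the horizon, $\xi^t=O(1)$, $\xi^\rho=O(\rho)$, $\xi^M=O(1)$, and the current $\omega^\mu=\omega^\mu(\bar g,\pounds_\eta\bar g,\pounds_\chi\bar g)$ satisfies $\omega^t=O(1)$, $\omega^\rho=O(\rho)$, $\omega^M=O(1)$. 3. The charges of $\mathcal A$ are integrable: for every metric $g=\phi^*\bar g$, where $\phi$ is a finite composition of time-one flow maps of elements of $\mathcal A$, and for all $\xi,\eta,\chi\in\mathcal A$, $$\int_{\partial\Sigma}(d^{D-2}x)_{\mu\nu}\,\xi^{[\mu}\omega^{\nu]}(g,\pounds_\eta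 g,\pounds_\chi g)=0 .$$ Here $\phi$ may be defined only on a relatively open set $W\subset\mathcal M$, and the integral is understood as follows: for every $t$ and every compact $K\subset U$ with $\{t\}\times\{0\}\times K\subset W$, the integrand $\xi^{[t}\omega^{\rho]}$ is integrable over $K$ for all small $\rho>0$, and $\lim_{\rho\to0^+}\int_K\xi^{[t}\omega^{\rho]}(t,\rho,x^M)\,d^{D-2}x=0$. -/

import Mathlib

open scoped ContDiff Topology
open Set Filter MeasureTheory

noncomputable section

namespace KillingHorizon

/-! Coordinates `(t, ρ, ψ, θ^A)` of a spacetime of dimension `D = n + 3`: the index `0` is `t`, `1` is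
`ρ`, `2` is `ψ`, and the remaining `n` indices are the `θ^A`.  The indices `M = 2, …, D - 1` of the
cross-section `(ψ, θ^A)` are the `M.succ.succ` with `M : Fin (n + 1)`. -/

/-- Coordinate space of a `D`-dimensional spacetime, `D = n + 3`. -/
abbrev Coord (n : ℕ) := Fin (n + 3) → ℝ

/-- The cross-section coordinates `x^M = (ψ, θ^A)` of a point. -/
def crossPt {n : ℕ} (x : Coord n) : Fin (n + 1) → ℝ := fun M => x M.succ.succ

/-- The coordinates `θ^A` of a point `(ψ, θ^A)` of the cross-section. -/
def thetaPt {n : ℕ} (y : Fin (n + 1) → ℝ) : Fin n → ℝ := fun A => y A.succ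

/-- The point with coordinates `(t, ρ, y)`. -/
def slicePt {n : ℕ} (t ρ : ℝ) (y : Fin (n + 1) → ℝ) : Coord n :=
  Matrix.vecCons t (Matrix.vecCons ρ y)

/-- The coordinate domain of the spacetime: `t` is arbitrary, `0 ≤ ρ < ρ₀`, and `(ψ, θ^A) ∈ U`. -/
def region {n : ℕ} (ρ₀ : ℝ) (U : Set (Fin (n + 1) → ℝ)) : Set (Coord n) :=
  {x | 0 ≤ x 1 ∧ x 1 < ρ₀ ∧ crossPt x ∈ U}

/-- The horizon `ρ = 0`, the union of the boundaries of the surfaces `t = const`. -/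
def horizon {n : ℕ} (ρ₀ : ℝ) (U : Set (Fin (n + 1) → ℝ)) : Set (Coord n) :=
  {x | x ∈ region ρ₀ U ∧ x 1 = 0}

/-- The part `ρ > 0` of the coordinate domain. -/
def exterior {n : ℕ} (ρ₀ : ℝ) (U : Set (Fin (n + 1) → ℝ)) : Set (Coord n) :=
  {x | x ∈ region ρ₀ U ∧ 0 < x 1}

/-! ### Asymptotics as `ρ → 0` -/

/-- `O(ρ^k)` for the coefficients of the expansion of smooth fields: `ρ^k` times a function that is
smooth up to and including the horizon.  For a function that is smooth on the domain `0 ≤ ρ < ρ₀`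
this is the same as being bounded by a multiple of `ρ^k`, locally uniformly at `ρ = 0`. -/
def SmoothO {n : ℕ} (ρ₀ : ℝ) (U : Set (Fin (n + 1) → ℝ)) (k : ℕ) (f : Coord n → ℝ) : Prop :=
  ∃ r : Coord n → ℝ, ContDiffOn ℝ ∞ r (region ρ₀ U) ∧ ∀ x ∈ region ρ₀ U, f x = x 1 ^ k * r x

/-- `O(ρ^k)` as `ρ → 0` for a function on `ρ > 0`, near every point of the horizon. -/
def HorizonBigO {n : ℕ} (ρ₀ : ℝ) (U : Set (Fin (n + 1) → ℝ)) (k : ℕ) (f : Coord n → ℝ) : Prop :=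
  ∀ p ∈ horizon ρ₀ U, f =O[𝓝[exterior ρ₀ U] p] fun x => x 1 ^ k

/-! ### Tensor calculus in coordinates -/

/-- The partial derivative `∂_μ f`. -/
def pd {n : ℕ} (μ : Fin (n + 3)) (f : Coord n → ℝ) (x : Coord n) : ℝ :=
  fderiv ℝ f x (Pi.single μ 1)

/-- Fields of covariant 2-tensors, by their components. -/
abbrev Tensor2 (n : ℕ) := Coord n → Matrix (Fin (n + 3)) (Fin (n + 3)) ℝ

/-- Vector fields, by their components. -/
abbrev VField (n : ℕ) := Coord n → Coord n

/-- The Lie derivative `(£_ξ h)_{μν} = ξ^α ∂_α h_{μν} + h_{αν} ∂_μ ξ^α + h_{μα} ∂_ν ξ^α`. -/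
def lieDeriv {n : ℕ} (ξ : VField n) (h : Tensor2 n) : Tensor2 n := fun x μ ν =>
  ∑ α, (ξ x α * pd α (fun y => h y μ ν) x + h x α ν * pd μ (fun y => ξ y α) x
    + h x μ α * pd ν (fun y => ξ y α) x)

/-- The pull-back `(φ^* h)_{μν}(x) = h_{αβ}(φ(x)) ∂_μ φ^α ∂_ν φ^β`. -/
def pullback {n : ℕ} (φ : Coord n → Coord n) (h : Tensor2 n) : Tensor2 n := fun x μ ν =>
  ∑ α, ∑ β, h (φ x) α β * pd μ (fun y => φ y α) x * pd ν (fun y => φ y β) x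

/-- The Christoffel symbol `Γ^α_{μν}` of the metric `g`. -/
def christoffel {n : ℕ} (g : Tensor2 n) (α μ ν : Fin (n + 3)) (x : Coord n) : ℝ :=
  (1 / 2) * ∑ β, (g x)⁻¹ α β *
    (pd μ (fun y => g y β ν) x + pd ν (fun y => g y β μ) x - pd β (fun y => g y μ ν) x)

/-- The covariant derivative `∇_γ h_{αβ}` with respect to the Levi-Civita connection of `g`. -/
def covDeriv {n : ℕ} (g h : Tensor2 n) (γ α β : Fin (n + 3)) (x : Coord n) : ℝ :=
  pd γ (fun y => h y α β) x
    - ∑ δ, (christoffel g δ γ α x * h x δ β + christoffel g δ γ β x * h x α δ)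

/-- The Ricci tensor
`R_{μν} = ∂_α Γ^α_{μν} - ∂_ν Γ^α_{μα} + Γ^α_{αβ} Γ^β_{μν} - Γ^α_{νβ} Γ^β_{μα}`. -/
def ricci {n : ℕ} (g : Tensor2 n) (μ ν : Fin (n + 3)) (x : Coord n) : ℝ :=
  ∑ α, (pd α (christoffel g α μ ν) x - pd ν (christoffel g α μ α) x
    + ∑ β, (christoffel g α α β x * christoffel g β μ ν x
      - christoffel g α ν β x * christoffel g β μ α x))

/-- The Ricci scalar `R = g^{μν} R_{μν}`. -/
def scalarCurv {n : ℕ} (g : Tensor2 n) (x : Coord n) : ℝ :=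
  ∑ μ, ∑ ν, (g x)⁻¹ μ ν * ricci g μ ν x

/-- The pre-symplectic current `ω^ν(g, δ₁g, δ₂g)` of general relativity with Newton constant `G`:
`√(-g)/(16πG)` times the contraction of
`g^{να}(g^{ρσ} g^{βγ} - 2 g^{ρβ} g^{σγ}) + 2 g^{νγ} g^{ρ[α} g^{σ]β} + g^{νρ} g^{αβ} g^{σγ}`
with `δ_{[1} g_{ρσ} ∇_γ δ_{2]} g_{αβ}`, the brackets `[ ]` including the factor `1/2`.
It equals `δ₁Θ^ν(g, δ₂g) - δ₂Θ^ν(g, δ₁g)` for the pre-symplectic potential `Θ` of the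
Einstein-Hilbert Lagrangian. -/
def presymplecticCurrent {n : ℕ} (G : ℝ) (g h₁ h₂ : Tensor2 n) (ν : Fin (n + 3))
    (x : Coord n) : ℝ :=
  Real.sqrt (-(g x).det) / (16 * Real.pi * G) *
    ∑ r, ∑ s, ∑ c, ∑ a, ∑ b,
      ((g x)⁻¹ ν a * ((g x)⁻¹ r s * (g x)⁻¹ b c - 2 * (g x)⁻¹ r b * (g x)⁻¹ s c)
        + 2 * (g x)⁻¹ ν c
          * ((1 / 2) * ((g x)⁻¹ r a * (g x)⁻¹ s b - (g x)⁻¹ r s * (g x)⁻¹ a b))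
        + (g x)⁻¹ ν r * (g x)⁻¹ a b * (g x)⁻¹ s c)
      * ((1 / 2) * (h₁ x r s * covDeriv g h₂ c a b x - h₂ x r s * covDeriv g h₁ c a b x))

/-! ### The background metric -/

/-- The background metric `g` near a Killing horizon at `ρ = 0`: a Lorentzian solution, for `ρ > 0`,
of the Einstein equations with cosmological constant `Λ`, with the prescribed expansion as `ρ → 0`,
where the coefficients are functions of `θ^A` only and `κ` is constant. -/
structure IsBackground {n : ℕ} (ρ₀ : ℝ) (U : Set (Fin (n + 1) → ℝ)) (Λ κ : ℝ)
    (ftψ : (Fin n → ℝ) → ℝ) (ftA : (Fin n → ℝ) → Fin n → ℝ) (fψψ : (Fin n → ℝ) → ℝ)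
    (Ω : (Fin n → ℝ) → Matrix (Fin n) (Fin n) ℝ) (g : Tensor2 n) : Prop where
  smooth_ftψ : ContDiffOn ℝ ∞ (fun y => ftψ (thetaPt y)) U
  smooth_ftA : ∀ A, ContDiffOn ℝ ∞ (fun y => ftA (thetaPt y) A) U
  smooth_fψψ : ContDiffOn ℝ ∞ (fun y => fψψ (thetaPt y)) U
  smooth_Ω : ∀ A B, ContDiffOn ℝ ∞ (fun y => Ω (thetaPt y) A B) U
  fψψ_pos : ∀ y ∈ U, 0 < fψψ (thetaPt y)
  Ω_posDef : ∀ y ∈ U, (Ω (thetaPt y)).PosDef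
  symm : ∀ x ∈ region ρ₀ U, (g x).IsSymm
  tt : SmoothO ρ₀ U 4 fun x => g x 0 0 - (-κ ^ 2 * x 1 ^ 2)
  tρ : SmoothO ρ₀ U 4 fun x => g x 0 1
  tψ : SmoothO ρ₀ U 4 fun x => g x 0 2 - ftψ (thetaPt (crossPt x)) * x 1 ^ 2
  tA : ∀ A : Fin n, SmoothO ρ₀ U 4 fun x =>
    g x 0 A.succ.succ.succ - ftA (thetaPt (crossPt x)) A * x 1 ^ 2
  ρρ : SmoothO ρ₀ U 2 fun x => g x 1 1 - 1
  ρψ : SmoothO ρ₀ U 4 fun x => g x 1 2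
  ρA : ∀ A : Fin n, SmoothO ρ₀ U 3 fun x => g x 1 A.succ.succ.succ
  ψψ : SmoothO ρ₀ U 2 fun x => g x 2 2 - fψψ (thetaPt (crossPt x))
  ψA : ∀ A : Fin n, SmoothO ρ₀ U 2 fun x => g x 2 A.succ.succ.succ
  AB : ∀ A B : Fin n, SmoothO ρ₀ U 2 fun x =>
    g x A.succ.succ.succ B.succ.succ.succ - Ω (thetaPt (crossPt x)) A B
  lorentzian : ∀ x ∈ exterior ρ₀ U, ∃ P : Matrix (Fin (n + 3)) (Fin (n + 3)) ℝ,
    IsUnit P.det ∧ P.transpose * g x * P = Matrix.diagonal fun μ => if μ = 0 then -1 else 1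
  einstein : ∀ x ∈ exterior ρ₀ U, ∀ μ ν,
    ricci g μ ν x - (1 / 2) * (scalarCurv g x - 2 * Λ) * g x μ ν = 0

/-! ### The algebra of supertranslations and superrotations -/

/-- `ξ = (T(x^M) + O(ρ²), O(ρ²), V^M(x^N) + O(ρ²))` with smooth `T` and `V^M`. -/
structure HasLeading {n : ℕ} (ρ₀ : ℝ) (U : Set (Fin (n + 1) → ℝ)) (ξ : VField n)
    (T : (Fin (n + 1) → ℝ) → ℝ) (V : (Fin (n + 1) → ℝ) → Fin (n + 1) → ℝ) : Prop where
  smooth_T : ContDiffOn ℝ ∞ T U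
  smooth_V : ContDiffOn ℝ ∞ V U
  t : SmoothO ρ₀ U 2 fun x => ξ x 0 - T (crossPt x)
  ρ : SmoothO ρ₀ U 2 fun x => ξ x 1
  cross : ∀ M : Fin (n + 1), SmoothO ρ₀ U 2 fun x => ξ x M.succ.succ - V (crossPt x) M

/-- The set of vector fields `(T + O(ρ²), O(ρ²), V^M + O(ρ²))` with arbitrary `T` and `V^M`. -/
def stsr {n : ℕ} (ρ₀ : ℝ) (U : Set (Fin (n + 1) → ℝ)) : Set (VField n) :=
  {ξ | ∃ T V, HasLeading ρ₀ U ξ T V}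

/-- `𝒜` is closed as an algebra of vector fields on the domain `0 ≤ ρ < ρ₀`: it is a linear space
and contains the commutators `[ξ, η]^μ = ξ^α ∂_α η^μ - η^α ∂_α ξ^μ` (one-sided derivatives at
`ρ = 0`). -/
def IsClosedAlgebra {n : ℕ} (ρ₀ : ℝ) (U : Set (Fin (n + 1) → ℝ)) (𝒜 : Set (VField n)) : Prop :=
  (0 : VField n) ∈ 𝒜 ∧ (∀ ξ ∈ 𝒜, ∀ η ∈ 𝒜, ξ + η ∈ 𝒜) ∧ (∀ c : ℝ, ∀ ξ ∈ 𝒜, c • ξ ∈ 𝒜) ∧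
    ∀ ξ ∈ 𝒜, ∀ η ∈ 𝒜, VectorField.lieBracketWithin ℝ ξ η (region ρ₀ U) ∈ 𝒜

/-! ### Integrability of the charges -/

/-- The sufficient condition for integrability, at the background metric `g`: the vector fields
preserve the horizon, `ξ^t = O(1)`, `ξ^ρ = O(ρ)`, `ξ^M = O(1)`, and the pre-symplectic current
`ω^μ(g, £_η g, £_χ g)` satisfies `ω^t = O(1)`, `ω^ρ = O(ρ)`, `ω^M = O(1)`. -/
def SufficientCondition {n : ℕ} (G ρ₀ : ℝ) (U : Set (Fin (n + 1) → ℝ)) (g : Tensor2 n)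
    (𝒜 : Set (VField n)) : Prop :=
  (∀ ξ ∈ 𝒜, HorizonBigO ρ₀ U 0 (fun x => ξ x 0) ∧ HorizonBigO ρ₀ U 1 (fun x => ξ x 1) ∧
    ∀ M : Fin (n + 1), HorizonBigO ρ₀ U 0 (fun x => ξ x M.succ.succ)) ∧
  ∀ η ∈ 𝒜, ∀ χ ∈ 𝒜,
    HorizonBigO ρ₀ U 0 (presymplecticCurrent G g (lieDeriv η g) (lieDeriv χ g) 0) ∧
    HorizonBigO ρ₀ U 1 (presymplecticCurrent G g (lieDeriv η g) (lieDeriv χ g) 1) ∧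
    ∀ M : Fin (n + 1), HorizonBigO ρ₀ U 0
      (presymplecticCurrent G g (lieDeriv η g) (lieDeriv χ g) M.succ.succ)

/-- `φ = exp ξ` on the relatively open set `W`: every point of `W` can be moved along the flow of
`ξ` for time `1` inside the spacetime domain, and `φ` is the resulting (smooth) map. -/
def IsExpOn {n : ℕ} (ρ₀ : ℝ) (U : Set (Fin (n + 1) → ℝ)) (ξ : VField n) (W : Set (Coord n))
    (φ : Coord n → Coord n) : Prop :=
  (∃ O : Set (Coord n), IsOpen O ∧ W = O ∩ region ρ₀ U) ∧
  ∃ Φ : ℝ → Coord n → Coord n,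
    ContDiffOn ℝ ∞ (fun p : ℝ × Coord n => Φ p.1 p.2) (Icc (0 : ℝ) 1 ×ˢ W) ∧
    ∀ x ∈ W, Φ 0 x = x ∧ Φ 1 x = φ x ∧ ∀ s ∈ Icc (0 : ℝ) 1, Φ s x ∈ region ρ₀ U ∧
      HasDerivWithinAt (fun s' => Φ s' x) (ξ (Φ s x)) (Icc 0 1) s

/-- The diffeomorphisms generated by `𝒜`: finite compositions `exp ξ⁽ᴺ⁾ ∘ ⋯ ∘ exp ξ⁽¹⁾` with
`ξ⁽ⁱ⁾ ∈ 𝒜`, on any relatively open set `W` of the spacetime domain on which they are defined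
(`W` may be the whole domain). -/
inductive Generated {n : ℕ} (ρ₀ : ℝ) (U : Set (Fin (n + 1) → ℝ)) (𝒜 : Set (VField n)) :
    Set (Coord n) → (Coord n → Coord n) → Prop
  | refl (O : Set (Coord n)) (hO : IsOpen O) : Generated ρ₀ U 𝒜 (O ∩ region ρ₀ U) id
  | step (W W' : Set (Coord n)) (φ φ' : Coord n → Coord n) (ξ : VField n)
      (hφ : Generated ρ₀ U 𝒜 W φ) (hξ : ξ ∈ 𝒜) (hφ' : IsExpOn ρ₀ U ξ W' φ')
      (hW : MapsTo φ W W') : Generated ρ₀ U 𝒜 W (φ' ∘ φ)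

/-- The integrand `ξ^{[t} ω^{ρ]}(g, £_η g, £_χ g)` of the integral of
`ξ^{[μ} ω^{ν]} (d^{D-2}x)_{μν}` over a surface of constant `t` and `ρ`. -/
def integrand {n : ℕ} (G : ℝ) (g : Tensor2 n) (ξ η χ : VField n) (x : Coord n) : ℝ :=
  (1 / 2) * (ξ x 0 * presymplecticCurrent G g (lieDeriv η g) (lieDeriv χ g) 1 x
    - ξ x 1 * presymplecticCurrent G g (lieDeriv η g) (lieDeriv χ g) 0 x)

/-- The charges are integrable: `∫_{∂Σ} ξ^{[μ} ω^{ν]}(g, £_η g, £_χ g) (d^{D-2}x)_{μν} = 0` for all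
`ξ, η, χ ∈ 𝒜` and all metrics `g = φ^* ḡ`, with `φ` a diffeomorphism generated by `𝒜`.
The integral over the boundary `∂Σ` of the surface `t = const` is the limit as `ρ → 0` of the
integrals at constant `t` and `ρ > 0`, and it is required to vanish over each compact piece `K` of
the cross-section. -/
def ChargesIntegrable {n : ℕ} (G ρ₀ : ℝ) (U : Set (Fin (n + 1) → ℝ)) (g : Tensor2 n)
    (𝒜 : Set (VField n)) : Prop :=
  ∀ (W : Set (Coord n)) (φ : Coord n → Coord n), Generated ρ₀ U 𝒜 W φ →
    ∀ ξ ∈ 𝒜, ∀ η ∈ 𝒜, ∀ χ ∈ 𝒜, ∀ (t : ℝ) (K : Set (Fin (n + 1) → ℝ)), IsCompact K →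
      (∀ y ∈ K, slicePt t 0 y ∈ W) →
      (∀ᶠ ρ in 𝓝[>] (0 : ℝ),
        IntegrableOn (fun y => integrand G (pullback φ g) ξ η χ (slicePt t ρ y)) K) ∧
      Tendsto (fun ρ => ∫ y in K, integrand G (pullback φ g) ξ η χ (slicePt t ρ y))
        (𝓝[>] (0 : ℝ)) (𝓝 0)

end KillingHorizon

end

noncomputable section

namespace KillingHorizon

/-! Commutators. A function `A(x^M) + O(ρ²)` differentiated along `ξ` gives `V^M ∂_M A + O(ρ²)`,
because `ξ^ρ = O(ρ²)` absorbs the power that `∂_ρ` costs. This is `HasLeading.directional`; applied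
to each component it yields the bracket.

The current. Give each lower index `t` the weight `ρ` and each upper one `ρ⁻¹`, as in the frame `ρ
dt, dρ, dx^M`, where the metric tends to the invertible block matrix with blocks `-κ²`, `1` and the
cross-section metric. For `h = £_η g` the point is that `∇_γ h_{αβ}` has its full weighted order
(`Metr.bd_covDeriv`). The symbols `Γ^t` and `Γ^ρ` lose one power of `ρ`, but every `h` with an index
`t` or `ρ` is one power smaller than its weight, since the algebra varies neither `κ` nor the
leading value `1` of `g_ρρ`. For `Γ^M` there is no loss: `∂_t g_{MN} = O(ρ)`, and the inverse
entries `g^{Mt}`, `g^{Mρ}` gain a power. Contracted indices then cancel in the current, and `√(-g) =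
O(ρ)` leaves `ω^t = O(1)` and `ω^ρ, ω^M = O(ρ)` (`Metr.bd_current`). Hence `ξ^t ω^ρ - ξ^ρ ω^t =
O(ρ)`, and its integral over a compact piece of the horizon tends to zero.

Other metrics of the orbit. The argument uses only the class `Metr`, which asks for less than the
prescribed expansion and is stable under pull-back (`Metr.pullW`). Since `ξ` is `(T, 0, V^M)` up to
`O(ρ²)`, `Dξ` kills `∂_t` and `∂_ρ` at the horizon, so the differential of its flow fixes both
vectors there (`IsExpOn.diffeo`). Compositions inherit this, and it determines the orders of the
Jacobian (`Diffeo.mapF`).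

Orders are recorded by `Van`, vanishing of `ρ`-derivatives at `ρ = 0`. All order bookkeeping depends
only on the type `t`, `ρ` or `M` of each index, so it reduces to inequalities between tables over
`Fin 3`, settled by `decide`. -/

variable {n : ℕ}

/-! ### Calculus on the half space `0 ≤ ρ` -/

/-- The half space `0 ≤ ρ`. -/
def half (n : ℕ) : Set (Coord n) := {x | 0 ≤ x 1}

/-- The open half space `0 < ρ`. -/
def pos (n : ℕ) : Set (Coord n) := {x | 0 < x 1}

lemma isOpen_pos : IsOpen (pos n) := isOpen_lt continuous_const (continuous_apply 1)

lemma pos_subset_half : pos n ⊆ half n := fun x (hx : 0 < x 1) => show 0 ≤ x 1 from hx.le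

lemma half_mem_nhds {x : Coord n} (hx : 0 < x 1) : half n ∈ 𝓝 x :=
  mem_of_superset (isOpen_pos.mem_nhds hx) pos_subset_half

lemma convex_half : Convex ℝ (half n) :=
  convex_halfSpace_ge (f := fun x : Coord n => x 1) ⟨fun _ _ => rfl, fun _ _ => rfl⟩ 0

lemma interior_half_nonempty : (interior (half n)).Nonempty :=
  ⟨fun _ => 1, mem_interior_iff_mem_nhds.2 (half_mem_nhds one_pos)⟩

lemma uniqueDiffOn_half : UniqueDiffOn ℝ (half n) :=
  uniqueDiffOn_convex convex_half interior_half_nonempty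

lemma half_subset_closure_interior : half n ⊆ closure (interior (half n)) := by
  rw [convex_half.closure_interior_eq_closure_of_nonempty_interior interior_half_nonempty]
  exact subset_closure

/-- The partial derivative `∂_μ f`, one-sided at `ρ = 0`. -/
def dW (μ : Fin (n + 3)) (f : Coord n → ℝ) (x : Coord n) : ℝ :=
  fderivWithin ℝ f (half n) x (Pi.single μ 1)

/-- A two-sided derivative at `ρ = 0` would involve values outside the domain. The calculus up to
the boundary therefore runs on `dW`, and results are carried over to `pd` where `ρ > 0`. -/
lemma pd_eq_dW {μ : Fin (n + 3)} {f : Coord n → ℝ} {x : Coord n} (hx : 0 < x 1) :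
    pd μ f x = dW μ f x := by
  rw [pd, dW, fderivWithin_of_mem_nhds (half_mem_nhds hx)]

/-- Smoothness, up to `ρ = 0`, at the points of `O` with `0 ≤ ρ`. -/
def Sm (O : Set (Coord n)) (f : Coord n → ℝ) : Prop :=
  ∀ x ∈ O, x ∈ half n → ContDiffWithinAt ℝ ∞ f (half n) x

section Sm
variable {O : Set (Coord n)} {f g : Coord n → ℝ}

lemma sm_iff (hO : IsOpen O) : Sm O f ↔ ContDiffOn ℝ ∞ f (O ∩ half n) := by
  constructor
  · intro h x hx
    exact (h x hx.1 hx.2).mono inter_subset_right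
  · intro h x hx hx'
    have := h x ⟨hx, hx'⟩
    rw [inter_comm] at this
    exact (contDiffWithinAt_inter (hO.mem_nhds hx)).1 this

lemma Sm.diff (h : Sm O f) {x : Coord n} (hx : x ∈ O) (hx' : x ∈ half n) :
    DifferentiableWithinAt ℝ f (half n) x :=
  (h x hx hx').differentiableWithinAt (by simp)

lemma Sm.deriv (h : Sm O f) (μ : Fin (n + 3)) : Sm O (dW μ f) := fun x hx hx' =>
  (h x hx hx').fderivWithin_right_apply contDiffWithinAt_const uniqueDiffOn_half
    (by simp) hx'

lemma Sm.add (hf : Sm O f) (hg : Sm O g) : Sm O (fun x => f x + g x) := fun x hx hx' =>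
  (hf x hx hx').add (hg x hx hx')

lemma Sm.mul (hf : Sm O f) (hg : Sm O g) : Sm O (fun x => f x * g x) := fun x hx hx' =>
  (hf x hx hx').mul (hg x hx hx')

lemma sm_const (c : ℝ) : Sm O (fun _ => c) := fun _ _ _ => contDiffWithinAt_const

lemma sm_coord (μ : Fin (n + 3)) : Sm O (fun x => x μ) := fun _ _ _ =>
  (contDiff_apply ℝ ℝ μ).contDiffWithinAt

lemma eventuallyEq_half (hO : IsOpen O) (h : ∀ x ∈ O, x ∈ half n → f x = g x) {x : Coord n}
    (hx : x ∈ O) : f =ᶠ[𝓝[half n] x] g := by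
  filter_upwards [mem_nhdsWithin_of_mem_nhds (hO.mem_nhds hx), self_mem_nhdsWithin] with y hy hy'
  exact h y hy hy'

lemma Sm.congr (hO : IsOpen O) (hf : Sm O f) (h : ∀ x ∈ O, x ∈ half n → g x = f x) : Sm O g :=
  fun x hx hx' => (hf x hx hx').congr_of_eventuallyEq (eventuallyEq_half hO h hx) (h x hx hx')

lemma dW_congr (hO : IsOpen O) (h : ∀ x ∈ O, x ∈ half n → f x = g x) (μ : Fin (n + 3))
    {x : Coord n} (hx : x ∈ O) (hx' : x ∈ half n) : dW μ f x = dW μ g x := by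
  rw [dW, dW,
    (eventuallyEq_half hO h hx).fderivWithin_eq (h x hx hx')]

lemma dW_add (hf : Sm O f) (hg : Sm O g) (μ : Fin (n + 3)) {x : Coord n} (hx : x ∈ O)
    (hx' : x ∈ half n) : dW μ (fun y => f y + g y) x = dW μ f x + dW μ g x := by
  simp only [dW]
  rw [fderivWithin_fun_add (uniqueDiffOn_half x hx') (hf.diff hx hx') (hg.diff hx hx')]
  rfl

lemma dW_mul (hf : Sm O f) (hg : Sm O g) (μ : Fin (n + 3)) {x : Coord n} (hx : x ∈ O)
    (hx' : x ∈ half n) : dW μ (fun y => f y * g y) x = dW μ f x * g x + f x * dW μ g x := by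
  simp only [dW]
  rw [fderivWithin_fun_mul (uniqueDiffOn_half x hx') (hf.diff hx hx') (hg.diff hx hx')]
  simp only [add_apply, smul_apply, smul_eq_mul]
  ring

lemma dW_const (μ : Fin (n + 3)) (c : ℝ) (x : Coord n) : dW μ (fun _ => c) x = 0 := by
  simp [dW]

lemma dW_coord (μ ν : Fin (n + 3)) {x : Coord n} (hx : x ∈ half n) :
    dW μ (fun y => y ν) x = if ν = μ then 1 else 0 := by
  simp only [dW]
  have h : HasFDerivWithinAt (fun y : Coord n => y ν)
      (ContinuousLinearMap.proj (R := ℝ) (φ := fun _ => ℝ) ν) (half n) x :=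
    (ContinuousLinearMap.proj (R := ℝ) (φ := fun _ => ℝ) ν).hasFDerivWithinAt
  rw [h.fderivWithin (uniqueDiffOn_half x hx)]
  simp [Pi.single_apply]

/-- Symmetry of the second derivative persists at boundary points because the half space lies in the
closure of its interior. -/
lemma dW_comm (hf : Sm O f) (μ ν : Fin (n + 3)) {x : Coord n} (hx : x ∈ O)
    (hx' : x ∈ half n) : dW μ (dW ν f) x = dW ν (dW μ f) x := by
  have hs : IsSymmSndFDerivWithinAt ℝ f (half n) x :=
    (hf x hx hx').isSymmSndFDerivWithinAt
      (by simpa using WithTop.coe_le_coe.2 (le_top : (2 : ℕ∞) ≤ ⊤)) uniqueDiffOn_half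
      (half_subset_closure_interior hx') hx'
  have key : ∀ μ ν : Fin (n + 3), dW μ (dW ν f) x
      = fderivWithin ℝ (fderivWithin ℝ f (half n)) (half n) x (Pi.single μ 1) (Pi.single ν 1) := by
    intro μ ν
    have hd : DifferentiableWithinAt ℝ (fderivWithin ℝ f (half n)) (half n) x :=
      ((hf x hx hx').fderivWithin_right (m := ∞) uniqueDiffOn_half (by simp) hx'
        ).differentiableWithinAt (by simp)
    have := hd.hasFDerivWithinAt.clm_apply
      (hasFDerivWithinAt_const (Pi.single ν (1 : ℝ) : Coord n) x (half n))
    have h2 := this.fderivWithin (uniqueDiffOn_half x hx')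
    change fderivWithin ℝ (fun y => fderivWithin ℝ f (half n) y (Pi.single ν 1)) (half n) x
      (Pi.single μ 1) = _
    rw [h2]
    simp
  rw [key, key, hs]

/-- Derivatives along the horizon of a function vanishing there vanish. -/
lemma dW_eq_zero (hO : IsOpen O) (hf : Sm O f) (h0 : ∀ x ∈ O, x 1 = 0 → f x = 0)
    {μ : Fin (n + 3)} (hμ : μ ≠ 1) {x : Coord n} (hx : x ∈ O) (hx1 : x 1 = 0) : dW μ f x = 0 := by
  have hx' : x ∈ half n := hx1.ge
  have hd := (hf.diff hx hx').hasFDerivWithinAt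
  set c : ℝ → Coord n := fun s => x + s • (Pi.single μ 1 : Coord n) with hc
  have hc' : HasDerivWithinAt c (Pi.single μ 1) univ 0 := by
    have := ((hasDerivAt_id (0 : ℝ)).smul_const (Pi.single μ 1 : Coord n)).const_add x
    rw [one_smul] at this
    exact this.hasDerivWithinAt
  have hmaps : ∀ s : ℝ, c s 1 = 0 := fun s => by simp [hc, hx1, hμ.symm]
  have e0 : c 0 = x := by simp [hc]
  rw [← e0] at hd
  have h1 := hd.comp_hasDerivWithinAt (0 : ℝ) hc' (fun s _ => (hmaps s).ge)
  have hz : f ∘ c =ᶠ[𝓝[univ] 0] fun _ => 0 := by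
    rw [nhdsWithin_univ]
    have hcont : Tendsto c (𝓝 0) (𝓝 x) := by
      have : Continuous c := by fun_prop
      simpa only [e0] using this.tendsto 0
    filter_upwards [hcont (hO.mem_nhds hx)] with s hs
    exact h0 _ hs (hmaps s)
  have h2 := ((hasDerivAt_const (0 : ℝ) (0 : ℝ)).hasDerivWithinAt
    (s := univ)).congr_of_eventuallyEq hz (by simp [e0, h0 x hx hx1])
  have h3 := (uniqueDiffWithinAt_univ (𝕜 := ℝ) (x := 0)).eq_deriv _ h1 h2
  rwa [e0] at h3

end Sm

/-- `f` is smooth up to `ρ = 0` on `O`, and its `ρ`-derivatives of order less than `k` vanish at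
`ρ = 0`. -/
def Van (O : Set (Coord n)) : ℕ → (Coord n → ℝ) → Prop
  | 0, f => Sm O f
  | k + 1, f => Sm O f ∧ (∀ x ∈ O, x 1 = 0 → f x = 0) ∧ Van O k (dW 1 f)

/-! ### Calculus of functions vanishing to finite order at the horizon -/

section Van
variable {O : Set (Coord n)} {f g : Coord n → ℝ} {k l : ℕ}

lemma Van.sm (h : Van O k f) : Sm O f := by
  cases k with
  | zero => exact h
  | succ k => exact h.1

lemma Van.zero_of (h : Van O (k + 1) f) {x : Coord n} (hx : x ∈ O) (hx1 : x 1 = 0) : f x = 0 :=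
  h.2.1 x hx hx1

lemma van_one (h : Sm O f) (h0 : ∀ x ∈ O, x 1 = 0 → f x = 0) : Van O 1 f := ⟨h, h0, h.deriv 1⟩

lemma van_two (h : Sm O f) (h0 : ∀ x ∈ O, x 1 = 0 → f x = 0)
    (h1 : ∀ x ∈ O, x 1 = 0 → dW 1 f x = 0) : Van O 2 f := ⟨h, h0, van_one (h.deriv 1) h1⟩

lemma Van.congr (hO : IsOpen O) (hf : Van O k f) (h : ∀ x ∈ O, x ∈ half n → g x = f x) :
    Van O k g := by
  induction k generalizing f g with
  | zero => exact Sm.congr hO hf h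
  | succ k ih =>
    refine ⟨hf.1.congr hO h, fun x hx hx1 => ?_, ih hf.2.2 fun x hx hx' => dW_congr hO h 1 hx hx'⟩
    rw [h x hx hx1.ge, hf.zero_of hx hx1]

lemma Van.subset {O' : Set (Coord n)} (hf : Van O k f) (h : O' ⊆ O) : Van O' k f := by
  induction k generalizing f with
  | zero => exact fun x hx hx' => hf x (h hx) hx'
  | succ k ih =>
    exact ⟨fun x hx hx' => hf.1 x (h hx) hx', fun x hx hx1 => hf.zero_of (h hx) hx1, ih hf.2.2⟩

lemma Van.mono (hf : Van O k f) (h : l ≤ k) : Van O l f := by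
  induction k generalizing f l with
  | zero => obtain rfl : l = 0 := by omega
            exact hf
  | succ k ih =>
    cases l with
    | zero => exact hf.1
    | succ l => exact ⟨hf.1, hf.2.1, ih hf.2.2 (by omega)⟩

lemma Van.add (hO : IsOpen O) (hf : Van O k f) (hg : Van O k g) :
    Van O k (fun x => f x + g x) := by
  induction k generalizing f g with
  | zero => exact Sm.add hf hg
  | succ k ih =>
    refine ⟨hf.1.add hg.1, fun x hx hx1 => ?_, (ih hf.2.2 hg.2.2).congr hO fun x hx hx' => ?_⟩
    · simp [hf.zero_of hx hx1, hg.zero_of hx hx1]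
    · exact dW_add hf.1 hg.1 1 hx hx'

lemma van_zero_fun : Van O k (fun _ => 0) := by
  induction k with
  | zero => exact sm_const 0
  | succ k ih =>
    refine ⟨sm_const 0, fun _ _ _ => rfl, ?_⟩
    have : dW (1 : Fin (n + 3)) (fun _ => (0 : ℝ)) = fun _ => 0 := funext fun x => dW_const 1 0 x
    rwa [this]

lemma Van.sum (hO : IsOpen O) {ι : Type*} (s : Finset ι) {F : ι → Coord n → ℝ}
    (h : ∀ i ∈ s, Van O k (F i)) : Van O k (fun x => ∑ i ∈ s, F i x) := by
  classical
  induction s using Finset.induction_on with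
  | empty => simpa using van_zero_fun
  | insert a s ha ih =>
    simp only [Finset.sum_insert ha]
    exact (h a (by simp)).add hO (ih fun i hi => h i (by simp [hi]))

lemma Van.mul (hO : IsOpen O) (hf : Van O k f) (hg : Van O l g) :
    Van O (k + l) (fun x => f x * g x) := by
  -- Induction on the total order: Leibniz produces products of orders `(k - 1, l)` and `(k, l -
  -- 1)`. Differentiating a factor of order `0` costs nothing, and the other factor then gives up
  -- one order.
  suffices H : ∀ m k l (f g : Coord n → ℝ), k + l = m → Van O k f → Van O l g →
      Van O m (fun x => f x * g x) from H _ _ _ _ _ rfl hf hg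
  intro m
  induction m with
  | zero => exact fun k l f g _ hf hg => Sm.mul hf.sm hg.sm
  | succ m ih =>
    intro k l f g hkl hf hg
    refine ⟨hf.sm.mul hg.sm, fun x hx hx1 => ?_, ?_⟩
    · rcases k with _ | k
      · rcases l with _ | l
        · omega
        · simp [hg.zero_of hx hx1]
      · simp [hf.zero_of hx hx1]
    · have h1 : Van O m (fun x => dW 1 f x * g x) := by
        rcases k with _ | k
        · rcases l with _ | l
          · omega
          · exact ih 0 l _ _ (by omega) (Sm.deriv hf 1) (hg.mono (by omega))
        · exact ih k l _ _ (by omega) hf.2.2 hg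
      have h2 : Van O m (fun x => f x * dW 1 g x) := by
        rcases l with _ | l
        · rcases k with _ | k
          · omega
          · exact ih k 0 _ _ (by omega) (hf.mono (by omega)) (Sm.deriv hg 1)
        · exact ih k l _ _ (by omega) hf hg.2.2
      exact (h1.add hO h2).congr hO fun x hx hx' => dW_mul hf.sm hg.sm 1 hx hx'

lemma Van.const_mul (hO : IsOpen O) (hf : Van O k f) (c : ℝ) : Van O k (fun x => c * f x) := by
  have := Van.mul hO (k := 0) (sm_const (O := O) c) hf
  rwa [zero_add] at this

lemma Van.neg (hO : IsOpen O) (hf : Van O k f) : Van O k (fun x => -f x) :=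
  (hf.const_mul hO (-1)).congr hO fun x _ _ => by ring

lemma Van.sub (hO : IsOpen O) (hf : Van O k f) (hg : Van O k g) :
    Van O k (fun x => f x - g x) :=
  (hf.add hO (hg.neg hO)).congr hO fun x _ _ => by ring

lemma van_rho : Van O 1 (fun x => x 1) := van_one (sm_coord 1) fun _ _ h => h

lemma van_rho_pow (hO : IsOpen O) : Van O k (fun x => x 1 ^ k) := by
  induction k with
  | zero => simp only [pow_zero]; exact sm_const 1
  | succ k ih => simpa only [pow_succ] using ih.mul hO van_rho

lemma Van.dW_rho (hf : Van O k f) : Van O (k - 1) (dW 1 f) := by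
  rcases k with _ | k
  · exact Sm.deriv hf 1
  · exact hf.2.2

/-- `∂_μ` commutes with `∂_ρ`, and a tangential derivative of a function vanishing on the horizon
vanishes there, so no order is lost. -/
lemma Van.dW_tangent (hO : IsOpen O) (hf : Van O k f) {μ : Fin (n + 3)} (hμ : μ ≠ 1) :
    Van O k (dW μ f) := by
  induction k generalizing f with
  | zero => exact Sm.deriv hf μ
  | succ k ih =>
    exact ⟨hf.1.deriv μ, fun x hx hx1 => dW_eq_zero hO hf.1 hf.2.1 hμ hx hx1,
      (ih hf.2.2).congr hO fun x hx hx' => dW_comm hf.1 1 μ hx hx'⟩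

lemma Van.deriv (hO : IsOpen O) (hf : Van O k f) (μ : Fin (n + 3)) : Van O (k - 1) (dW μ f) := by
  by_cases hμ : μ = 1
  · subst hμ; exact hf.dW_rho
  · exact (hf.dW_tangent hO hμ).mono (by omega)

/-- The chain rule. -/
lemma dW_comp {O' : Set (Coord n)} (hO : IsOpen O) {φ : Coord n → Coord n}
    (hφ : ∀ μ, Sm O (fun x => φ x μ)) (hm : ∀ x ∈ O, x ∈ half n → φ x ∈ O' ∧ φ x ∈ half n)
    (hf : Sm O' f) (μ : Fin (n + 3)) {x : Coord n} (hx : x ∈ O) (hx' : x ∈ half n) :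
    dW μ (fun y => f (φ y)) x = ∑ α, dW α f (φ x) * dW μ (fun y => φ y α) x := by
  have h1 := (hf.diff (hm x hx hx').1 (hm x hx hx').2).hasFDerivWithinAt
  have h2 : HasFDerivWithinAt φ (ContinuousLinearMap.pi fun α =>
      fderivWithin ℝ (fun y => φ y α) (half n) x) (half n ∩ O) x :=
    hasFDerivWithinAt_pi'.2 fun α => by
      simpa using ((hφ α).diff hx hx').hasFDerivWithinAt.mono inter_subset_left
  have h3 := h1.comp x h2 (fun y hy => (hm y hy.2 hy.1).2)
  have h4 := (hasFDerivWithinAt_inter (hO.mem_nhds hx)).1 h3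
  have h5 : fderivWithin ℝ (fun y => f (φ y)) (half n) x = _ :=
    h4.fderivWithin (uniqueDiffOn_half x hx')
  rw [dW, h5]
  set A := fderivWithin ℝ f (half n) (φ x)
  have h6 : ∀ v : Coord n, A v = ∑ α, A (Pi.single α 1) * v α := by
    intro v
    conv_lhs => rw [← Finset.univ_sum_single v, map_sum]
    refine Finset.sum_congr rfl fun α _ => ?_
    have : (Pi.single α (v α) : Coord n) = v α • Pi.single α 1 := by
      rw [← Pi.single_smul]; simp
    rw [this, map_smul, smul_eq_mul, mul_comm]
  rw [ContinuousLinearMap.comp_apply, h6]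
  rfl

lemma Sm.comp {O' : Set (Coord n)} (hO : IsOpen O) {φ : Coord n → Coord n}
    (hφ : ∀ μ, Sm O (fun x => φ x μ)) (hm : ∀ x ∈ O, x ∈ half n → φ x ∈ O' ∧ φ x ∈ half n)
    (hf : Sm O' f) : Sm O (fun x => f (φ x)) := by
  intro x hx hx'
  have h1 := hf _ (hm x hx hx').1 (hm x hx hx').2
  have h2 : ContDiffWithinAt ℝ ∞ φ (half n ∩ O) x :=
    contDiffWithinAt_pi.2 fun α => (hφ α x hx hx').mono inter_subset_left
  exact (contDiffWithinAt_inter (hO.mem_nhds hx)).1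
    (h1.comp x h2 (fun y hy => (hm y hy.2 hy.1).2))

/-- Composition with maps that preserve the horizon. -/
lemma Van.comp {O' : Set (Coord n)} (hO : IsOpen O) (hO' : IsOpen O') {φ : Coord n → Coord n}
    (hφ : ∀ μ, Sm O (fun x => φ x μ)) (hm : ∀ x ∈ O, x ∈ half n → φ x ∈ O' ∧ φ x ∈ half n)
    (h1 : ∀ x ∈ O, x 1 = 0 → φ x 1 = 0) (hf : Van O' k f) : Van O k (fun x => f (φ x)) := by
  induction k generalizing f with
  | zero => exact Sm.comp hO hφ hm hf
  | succ k ih =>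
    refine ⟨hf.1.comp hO hφ hm, fun x hx hx1 => hf.zero_of (hm x hx hx1.ge).1 (h1 x hx hx1), ?_⟩
    refine Van.congr hO (Van.sum hO Finset.univ (F := fun α x => dW α f (φ x) *
      dW 1 (fun y => φ y α) x) fun α _ => ?_)
      (fun x hx hx' => dW_comp hO hφ hm hf.1 1 hx hx')
    have h2 : Van O k (fun x => dW α f (φ x)) := ih (hf.deriv hO' α)
    exact h2.mul hO (l := 0) (Sm.deriv (hφ α) 1)

end Van

/-! ### Orders of magnitude at a point of the horizon -/

/-- `f = O(ρ^k)` on `ρ > 0`, near the point `p`. -/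
def Bd (p : Coord n) (k : ℤ) (f : Coord n → ℝ) : Prop :=
  f =O[𝓝[pos n] p] fun x => x 1 ^ k

section Bd
variable {p : Coord n} {k l : ℤ} {f g : Coord n → ℝ}

lemma Bd.add (hf : Bd p k f) (hg : Bd p k g) : Bd p k (fun x => f x + g x) :=
  Asymptotics.IsBigO.add hf hg

lemma Bd.neg (hf : Bd p k f) : Bd p k (fun x => -f x) :=
  Asymptotics.IsBigO.neg_left hf

lemma Bd.sub (hf : Bd p k f) (hg : Bd p k g) : Bd p k (fun x => f x - g x) :=
  Asymptotics.IsBigO.sub hf hg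

lemma Bd.const_mul (hf : Bd p k f) (c : ℝ) : Bd p k (fun x => c * f x) :=
  Asymptotics.IsBigO.const_mul_left hf c

lemma eventually_pos : ∀ᶠ x in 𝓝[pos n] p, 0 < x 1 := self_mem_nhdsWithin

lemma Bd.mul (hf : Bd p k f) (hg : Bd p l g) : Bd p (k + l) (fun x => f x * g x) := by
  refine (Asymptotics.IsBigO.mul hf hg).congr' EventuallyEq.rfl ?_
  filter_upwards [eventually_pos] with x hx
  rw [zpow_add₀ hx.ne']

lemma Bd.sum {ι : Type*} (s : Finset ι) {F : ι → Coord n → ℝ} (h : ∀ i ∈ s, Bd p k (F i)) :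
    Bd p k (fun x => ∑ i ∈ s, F i x) :=
  Asymptotics.IsBigO.fun_sum h

lemma Bd.congr (hf : Bd p k f) (h : g =ᶠ[𝓝[pos n] p] f) : Bd p k g :=
  Asymptotics.IsBigO.congr' hf h.symm EventuallyEq.rfl

lemma eventually_lt (hp : p 1 = 0) {ε : ℝ} (hε : 0 < ε) : ∀ᶠ x in 𝓝[pos n] p, x 1 < ε := by
  refine mem_nhdsWithin_of_mem_nhds ((isOpen_lt (continuous_apply 1) continuous_const).mem_nhds ?_)
  show p 1 < ε
  rwa [hp]

lemma Bd.mono (hp : p 1 = 0) (hf : Bd p k f) (h : l ≤ k) : Bd p l f := by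
  refine Asymptotics.IsBigO.trans hf (Asymptotics.IsBigO.of_bound 1 ?_)
  filter_upwards [eventually_pos, eventually_lt hp one_pos] with x hx hx1
  rw [one_mul, Real.norm_of_nonneg (zpow_nonneg hx.le _), Real.norm_of_nonneg (zpow_nonneg hx.le _)]
  exact zpow_le_zpow_right_of_le_one₀ hx hx1.le h

lemma bd_rho_zpow : Bd p k (fun x => x 1 ^ k) := Asymptotics.isBigO_refl _ _

lemma bd_of_tendsto {a : ℝ} (h : Tendsto f (𝓝[pos n] p) (𝓝 a)) : Bd p 0 f := by
  have := h.isBigO_one ℝ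
  simpa [Bd] using this

lemma tendsto_rho (hp : p 1 = 0) : Tendsto (fun x : Coord n => x 1) (𝓝[pos n] p) (𝓝 0) := by
  have := ((continuous_apply (A := fun _ => ℝ) (1 : Fin (n + 3))).tendsto p).mono_left
    (nhdsWithin_le_nhds (s := pos n))
  simpa only [hp] using this

lemma Bd.tendsto_zero (hp : p 1 = 0) (hf : Bd p 1 f) : Tendsto f (𝓝[pos n] p) (𝓝 0) := by
  refine Asymptotics.IsBigO.trans_tendsto hf ?_
  simpa using tendsto_rho hp

end Bd

/-- Integrate in from the horizon: along the segment from `ρ = 0` to `x` the inductive bound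
controls `∂_ρ f`, and the mean value inequality adds one factor `ρ`. -/
lemma Van.exists_bound {O : Set (Coord n)} (hO : IsOpen O) {p : Coord n} (hp : p ∈ O)
    (hp1 : p 1 = 0) {k : ℕ} {f : Coord n → ℝ} (hf : Van O k f) :
    ∃ C ε : ℝ, 0 ≤ C ∧ 0 < ε ∧ ∀ x ∈ Metric.ball p ε ∩ half n, ‖f x‖ ≤ C * x 1 ^ k := by
  induction k generalizing f with
  | zero =>
    have hc := (hf p hp hp1.ge).continuousWithinAt.norm
    have h1 : ∀ᶠ x in 𝓝[half n] p, ‖f x‖ < ‖f p‖ + 1 :=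
      hc.eventually (gt_mem_nhds (lt_add_one _))
    obtain ⟨ε, hε, h⟩ := Metric.mem_nhdsWithin_iff.1 h1
    exact ⟨‖f p‖ + 1, ε, by positivity, hε, fun x hx => by simpa using (h hx).le⟩
  | succ k ih =>
    obtain ⟨C, ε, hC, hε, h⟩ := ih hf.2.2
    obtain ⟨δ, hδ, hδO⟩ := Metric.isOpen_iff.1 hO p hp
    refine ⟨C, min ε δ, hC, lt_min hε hδ, fun x hx => ?_⟩
    have hx1 : 0 ≤ x 1 := hx.2
    set c : ℝ → Coord n := fun s => Function.update x 1 s with hc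
    have hcp : ∀ s ∈ Icc 0 (x 1), c s ∈ Metric.ball p (min ε δ) := by
      intro s hs
      have h1 := (dist_pi_lt_iff (lt_min hε hδ)).1 (Metric.mem_ball.1 hx.1)
      rw [Metric.mem_ball, dist_pi_lt_iff (lt_min hε hδ)]
      intro i
      by_cases hi : i = 1
      · subst hi
        have h2 := h1 1
        simp only [hc, Function.update_self]
        rw [Real.dist_eq, hp1, sub_zero] at h2 ⊢
        rw [abs_of_nonneg hs.1]
        rw [abs_of_nonneg hx1] at h2
        exact hs.2.trans_lt h2
      · simpa [hc, hi] using h1 i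
    have hch : ∀ s ∈ Icc 0 (x 1), c s ∈ half n := fun s hs => by
      show 0 ≤ c s 1
      simpa [hc] using hs.1
    have hcd : ∀ s, HasDerivAt c (Pi.single 1 1) s := fun s => hasDerivAt_update x 1 s
    have hd : ∀ s ∈ Icc 0 (x 1), HasDerivWithinAt (f ∘ c) (dW 1 f (c s)) (Icc 0 (x 1)) s := by
      intro s hs
      exact ((hf.1.diff (hδO (Metric.ball_subset_ball (min_le_right _ _) (hcp s hs)))
        (hch s hs)).hasFDerivWithinAt).comp_hasDerivWithinAt s (hcd s).hasDerivWithinAt hch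
    have hb : ∀ s ∈ Icc 0 (x 1), ‖dW 1 f (c s)‖ ≤ C * x 1 ^ k := by
      intro s hs
      refine (h (c s) ⟨Metric.ball_subset_ball (min_le_left _ _) (hcp s hs), hch s hs⟩).trans ?_
      have : c s 1 = s := by simp [hc]
      rw [this]
      exact mul_le_mul_of_nonneg_left (pow_le_pow_left₀ hs.1 hs.2 k) hC
    have := (convex_Icc 0 (x 1)).norm_image_sub_le_of_norm_hasDerivWithin_le hd hb
      (left_mem_Icc.2 hx1) (right_mem_Icc.2 hx1)
    have e0 : f (c 0) = 0 := hf.zero_of (hδO (Metric.ball_subset_ball (min_le_right _ _)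
      (hcp 0 (left_mem_Icc.2 hx1)))) (by simp [hc])
    have e1 : c (x 1) = x := by simp [hc]
    simp only [Function.comp, e0, e1, sub_zero, Real.norm_of_nonneg hx1] at this
    rwa [pow_succ, ← mul_assoc]

lemma Van.bd {O : Set (Coord n)} (hO : IsOpen O) {p : Coord n} (hp : p ∈ O)
    (hp1 : p 1 = 0) {k : ℕ} {f : Coord n → ℝ} (hf : Van O k f) : Bd p k f := by
  obtain ⟨C, ε, hC, hε, h⟩ := hf.exists_bound hO hp hp1
  refine Asymptotics.IsBigO.of_bound C ?_
  filter_upwards [eventually_pos, mem_nhdsWithin_of_mem_nhds (Metric.ball_mem_nhds p hε)]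
    with x hx hx'
  refine (h x ⟨hx', hx.le⟩).trans (le_of_eq ?_)
  rw [zpow_natCast, Real.norm_of_nonneg (pow_nonneg hx.le k)]

lemma Sm.tendsto {O : Set (Coord n)} {p : Coord n} (hp : p ∈ O)
    (hp1 : p 1 = 0) {f : Coord n → ℝ} (hf : Sm O f) : Tendsto f (𝓝[pos n] p) (𝓝 (f p)) :=
  (hf p hp hp1.ge).continuousWithinAt.tendsto.mono_left (nhdsWithin_mono _ pos_subset_half)

/-! ### Inverse matrices -/

section Inverse

variable {ι X : Type*} [Fintype ι] [DecidableEq ι]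

lemma tendsto_inv_matrix {l : Filter X} {A : X → Matrix ι ι ℝ} {A₀ : Matrix ι ι ℝ}
    (h : Tendsto A l (𝓝 A₀)) (h0 : A₀.det ≠ 0) : Tendsto (fun x => (A x)⁻¹) l (𝓝 A₀⁻¹) := by
  have hc : ContinuousAt (fun M : Matrix ι ι ℝ => M⁻¹) A₀ := by
    have h1 : ContinuousAt (fun M : Matrix ι ι ℝ => M.det⁻¹) A₀ :=
      (Continuous.matrix_det continuous_id).continuousAt.inv₀ h0
    have h2 : ContinuousAt (fun M : Matrix ι ι ℝ => M.adjugate) A₀ :=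
      (Continuous.matrix_adjugate continuous_id).continuousAt
    have : (fun M : Matrix ι ι ℝ => M⁻¹) = fun M => M.det⁻¹ • M.adjugate := by
      funext M
      rw [Matrix.inv_def, Ring.inverse_eq_inv']
    rw [this]
    exact h1.smul h2
  exact hc.tendsto.comp h

lemma inv_conj_diagonal {d : ι → ℝ} (hd : ∀ i, d i ≠ 0) {A B : Matrix ι ι ℝ}
    (h : ∀ i j, A i j = d i * B i j * d j) (i j : ι) :
    A⁻¹ i j = (d i)⁻¹ * B⁻¹ i j * (d j)⁻¹ := by
  have hA : A = Matrix.diagonal d * B * Matrix.diagonal d := by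
    ext i j
    rw [Matrix.mul_diagonal, Matrix.diagonal_mul, h]
  have hi : (Matrix.diagonal d)⁻¹ = Matrix.diagonal fun i => (d i)⁻¹ := by
    refine Matrix.inv_eq_right_inv ?_
    rw [Matrix.diagonal_mul_diagonal, ← Matrix.diagonal_one]
    congr 1
    funext i
    exact mul_inv_cancel₀ (hd i)
  rw [hA, Matrix.mul_inv_rev, Matrix.mul_inv_rev, hi, ← mul_assoc, Matrix.mul_diagonal,
    Matrix.diagonal_mul]

end Inverse

/-- If the column `j` of `A` is `O(ρ)` off the diagonal, then so is that of `A⁻¹`. -/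
lemma bd_inv_offdiag {ι : Type*} [Fintype ι] [DecidableEq ι] {p : Coord n} (hp : p 1 = 0)
    {A : Coord n → Matrix ι ι ℝ}
    (hinv : ∀ i j, Bd p 0 (fun x => (A x)⁻¹ i j)) (hdet : ∀ᶠ x in 𝓝[pos n] p, (A x).det ≠ 0)
    {j : ι} (hA : ∀ i, i ≠ j → Bd p 1 (fun x => A x i j)) {a : ℝ} (ha : a ≠ 0)
    (hj : Tendsto (fun x => A x j j) (𝓝[pos n] p) (𝓝 a)) {i : ι} (hij : i ≠ j) :
    Bd p 1 (fun x => (A x)⁻¹ i j) := by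
  -- This is `(A⁻¹ A)_{ij} = 0` solved for the entry `(A⁻¹)_{ij}`; every remaining term contains an
  -- off-diagonal entry of column `j`.
  have h1 : Bd p 1 (fun x => -(∑ b ∈ Finset.univ.erase j, (A x)⁻¹ i b * A x b j) * (A x j j)⁻¹) := by
    have := ((Bd.sum (k := 1) (Finset.univ.erase j) (F := fun b x => (A x)⁻¹ i b * A x b j)
      fun b hb => ((hinv i b).mul (hA b (Finset.ne_of_mem_erase hb))).mono hp (by simp)).neg).mul
      (bd_of_tendsto (hj.inv₀ ha))
    exact this.mono hp (by simp)
  refine h1.congr ?_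
  filter_upwards [hdet, hj.eventually_ne ha] with x hx hx'
  have h2 : ((A x)⁻¹ * A x) i j = 0 := by
    rw [Matrix.nonsing_inv_mul _ (isUnit_iff_ne_zero.2 hx), Matrix.one_apply_ne hij]
  rw [Matrix.mul_apply, ← Finset.add_sum_erase _ _ (Finset.mem_univ j)] at h2
  rw [eq_mul_inv_iff_mul_eq₀ hx']
  linarith

/-! ### Vanishing orders of the components of the fields -/

/-- The type of a coordinate: `0` for `t`, `1` for `ρ` and `2` for the cross-section. -/
def cls (μ : Fin (n + 3)) : Fin 3 := Fin.cases 0 (Fin.cases 1 fun _ => 2) μ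

@[simp] lemma cls_zero : cls (0 : Fin (n + 3)) = 0 := rfl
@[simp] lemma cls_one : cls (1 : Fin (n + 3)) = 1 := rfl
@[simp] lemma cls_succ (M : Fin (n + 1)) : cls M.succ.succ = 2 := rfl

lemma index_cases {P : Fin (n + 3) → Prop} (h0 : P 0) (h1 : P 1)
    (h2 : ∀ M : Fin (n + 1), P M.succ.succ) (μ : Fin (n + 3)) : P μ := by
  refine Fin.cases h0 (fun i => ?_) μ
  exact Fin.cases h1 (fun M => h2 M) i

lemma succ_ne_one (M : Fin (n + 1)) : (M.succ.succ : Fin (n + 3)) ≠ 1 :=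
  fun h => Fin.succ_ne_zero M (Fin.succ_injective _ h)

lemma cls_eq_zero {μ : Fin (n + 3)} : cls μ = 0 ↔ μ = 0 := by
  cases μ using index_cases <;> simp

lemma cls_eq_one {μ : Fin (n + 3)} : cls μ = 1 ↔ μ = 1 := by
  cases μ using index_cases <;> simp [succ_ne_one]

lemma sum_index (f : Fin (n + 3) → ℝ) : ∑ α, f α = f 0 + f 1 + ∑ M : Fin (n + 1), f M.succ.succ := by
  rw [Fin.sum_univ_succ, Fin.sum_univ_succ]
  exact (add_assoc _ _ _).symm

lemma sum_cross {f : Fin (n + 3) → ℝ} (h : ∀ α, cls α ≠ 2 → f α = 0) :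
    ∑ α, f α = ∑ M : Fin (n + 1), f M.succ.succ := by
  rw [sum_index, h 0 (by simp), h 1 (by simp), zero_add, zero_add]

/-- Orders of the components of the metric. -/
def ordG : Fin 3 → Fin 3 → ℕ := ![![2, 2, 2], ![2, 0, 1], ![2, 1, 0]]

/-- Orders of the derivatives `∂_μ g_{αβ}` of the metric. -/
def ordDG : Fin 3 → Fin 3 → Fin 3 → ℕ :=
  ![![![3, 2, 2], ![2, 1, 1], ![2, 1, 1]], ![![1, 1, 1], ![1, 0, 0], ![1, 0, 0]],
    ![![3, 2, 2], ![2, 1, 1], ![2, 1, 0]]]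

/-- Orders of the components of a variation of the metric. -/
def ordH : Fin 3 → Fin 3 → ℕ := ![![3, 2, 2], ![2, 1, 1], ![2, 1, 0]]

/-- Orders of the derivatives `∂_μ h_{αβ}` of a variation of the metric. -/
def ordDH : Fin 3 → Fin 3 → Fin 3 → ℕ :=
  ![![![3, 2, 2], ![2, 1, 1], ![2, 1, 1]], ![![2, 1, 1], ![1, 0, 0], ![1, 0, 0]],
    ![![3, 2, 2], ![2, 1, 1], ![2, 1, 0]]]

/-- Orders of the components of a vector field of the algebra. -/
def ordV : Fin 3 → ℕ := ![0, 2, 0]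

/-- Orders of the derivatives `∂_μ ξ^α` of a vector field of the algebra. -/
def ordDV : Fin 3 → Fin 3 → ℕ := ![![2, 2, 2], ![1, 1, 1], ![0, 2, 0]]

/-- Orders of the derivatives `∂_μ φ^α` of a diffeomorphism generated by the algebra. -/
def ordJ : Fin 3 → Fin 3 → ℕ := ![![0, 2, 2], ![1, 0, 1], ![0, 2, 0]]

/-- Vector fields `(T + O(ρ²), O(ρ²), V^M + O(ρ²))` on `O`. -/
structure VecF (O : Set (Coord n)) (ξ : VField n) : Prop where
  val : ∀ α, Van O (ordV (cls α)) (fun x => ξ x α)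
  der : ∀ μ α, Van O (ordDV (cls μ) (cls α)) (dW μ fun x => ξ x α)

/-- Variations of metrics that are preserved by the algebra. -/
structure Tens (O : Set (Coord n)) (h : Tensor2 n) : Prop where
  ord : ∀ α β, Van O (ordH (cls α) (cls β)) (fun x => h x α β)
  der : ∀ μ α β, Van O (ordDH (cls μ) (cls α) (cls β)) (dW μ fun x => h x α β)

/-- Metrics with the asymptotics that are preserved by the algebra. -/
structure Metr (κ : ℝ) (O : Set (Coord n)) (g : Tensor2 n) : Prop where
  ord : ∀ α β, Van O (ordG (cls α) (cls β)) (fun x => g x α β)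
  der : ∀ μ α β, Van O (ordDG (cls μ) (cls α) (cls β)) (dW μ fun x => g x α β)
  tt : Van O 3 fun x => g x 0 0 + κ ^ 2 * x 1 ^ 2
  rr : Van O 1 fun x => g x 1 1 - 1
  nondeg : ∀ p ∈ O, p 1 = 0 →
    (Matrix.of fun M N : Fin (n + 1) => g p M.succ.succ N.succ.succ).det ≠ 0

/-- Maps with the asymptotics of the diffeomorphisms generated by the algebra. -/
structure MapF (O O' : Set (Coord n)) (φ : Coord n → Coord n) : Prop where
  sm : ∀ α, Sm O (fun x => φ x α)
  maps : ∀ x ∈ O, x ∈ half n → φ x ∈ O' ∧ φ x ∈ half n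
  horizon : ∀ x ∈ O, x 1 = 0 → φ x 1 = 0
  jac : ∀ μ α, Van O (ordJ (cls μ) (cls α)) (dW μ fun x => φ x α)
  tt : Van O 1 fun x => dW 0 (fun x => φ x 0) x - 1
  rr : Van O 1 fun x => dW 1 (fun x => φ x 1) x - 1
  rho : Van O 2 fun x => φ x 1 - x 1
  nondeg : ∀ p ∈ O, p 1 = 0 →
    (Matrix.of fun M N : Fin (n + 1) => dW M.succ.succ (fun x => φ x N.succ.succ) p).det ≠ 0

/-- Functions whose `t`-derivative vanishes at the horizon. -/
def TVan (O : Set (Coord n)) (f : Coord n → ℝ) : Prop := Sm O f ∧ Van O 1 (dW 0 f)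

/-! ### Functions that are stationary at the horizon to leading order -/

section TVan
variable {O : Set (Coord n)} {f g : Coord n → ℝ}

lemma Van.tvan (hO : IsOpen O) {k : ℕ} (hf : Van O k f) (hk : 1 ≤ k) : TVan O f :=
  ⟨hf.sm, (hf.dW_tangent hO (by simp)).mono hk⟩

lemma TVan.add (hO : IsOpen O) (hf : TVan O f) (hg : TVan O g) : TVan O fun x => f x + g x :=
  ⟨hf.1.add hg.1, (hf.2.add hO hg.2).congr hO fun _ hx hx' => dW_add hf.1 hg.1 0 hx hx'⟩

lemma TVan.mul (hO : IsOpen O) (hf : TVan O f) (hg : TVan O g) : TVan O fun x => f x * g x := by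
  refine ⟨hf.1.mul hg.1, Van.congr hO (Van.add hO ?_ ?_)
    fun _ hx hx' => dW_mul hf.1 hg.1 0 hx hx'⟩
  · exact hf.2.mul hO (l := 0) hg.1
  · exact Van.mul hO (k := 0) hf.1 hg.2

lemma TVan.sum (hO : IsOpen O) {ι : Type*} (s : Finset ι) {F : ι → Coord n → ℝ}
    (h : ∀ i ∈ s, TVan O (F i)) : TVan O (fun x => ∑ i ∈ s, F i x) := by
  classical
  induction s using Finset.induction_on with
  | empty => simpa using (van_zero_fun (k := 1)).tvan hO le_rfl
  | insert a s ha ih =>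
    simp only [Finset.sum_insert ha]
    exact (h a (by simp)).add hO (ih fun i hi => h i (by simp [hi]))

lemma TVan.dW_tangent (hO : IsOpen O) (hf : TVan O f) {μ : Fin (n + 3)} (hμ : μ ≠ 1) :
    TVan O (dW μ f) :=
  ⟨hf.1.deriv μ, (hf.2.dW_tangent hO hμ).congr hO fun _ hx hx' => dW_comm hf.1 0 μ hx hx'⟩

end TVan

/-- The Lie derivative, with one-sided derivatives at the horizon. -/
def lieW (ξ : VField n) (h : Tensor2 n) : Tensor2 n := fun x μ ν =>
  ∑ α, (ξ x α * dW α (fun y => h y μ ν) x + h x α ν * dW μ (fun y => ξ y α) x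
    + h x μ α * dW ν (fun y => ξ y α) x)

/-- The pull-back, with one-sided derivatives at the horizon. -/
def pullW (φ : Coord n → Coord n) (h : Tensor2 n) : Tensor2 n := fun x μ ν =>
  ∑ α, ∑ β, h (φ x) α β * dW μ (fun y => φ y α) x * dW ν (fun y => φ y β) x

/-! ### Stability of the asymptotic classes under Lie derivatives and pull-backs -/

section classes
variable {O O' : Set (Coord n)} {ξ : VField n} {h g : Tensor2 n} {φ : Coord n → Coord n} {κ : ℝ}

lemma VecF.mk' (hO : IsOpen O) (hs : ∀ α, Sm O fun x => ξ x α) (h1 : Van O 2 fun x => ξ x 1)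
    (ht : ∀ α, Van O 2 (dW 0 fun x => ξ x α)) (hr : ∀ α, Van O 1 (dW 1 fun x => ξ x α)) :
    VecF O ξ where
  val := by
    intro α
    cases α using index_cases with
    | h0 => exact hs _
    | h1 => exact h1
    | h2 M => exact hs _
  der := by
    intro μ α
    cases μ using index_cases with
    | h0 => cases α using index_cases <;> exact ht _
    | h1 => cases α using index_cases <;> exact hr _
    | h2 M =>
      cases α using index_cases with
      | h0 => exact (hs _).deriv _
      | h1 => exact h1.dW_tangent hO (succ_ne_one M)
      | h2 N => exact (hs _).deriv _

lemma VecF.tvan (hξ : VecF O ξ) (α : Fin (n + 3)) : TVan O fun x => ξ x α := by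
  refine ⟨(hξ.val α).sm, (hξ.der 0 α).mono ?_⟩
  exact (show ∀ a : Fin 3, 1 ≤ ordDV 0 a by decide) _

/-- Tangential derivatives keep the order and `∂_ρ` lowers it by one; `ordDH` asks for more only in
`∂_t` of the cross-section block, which `ht` supplies. -/
lemma Tens.mk' (hO : IsOpen O) (ho : ∀ α β, Van O (ordH (cls α) (cls β)) (fun x => h x α β))
    (ht : ∀ M N : Fin (n + 1), TVan O fun x => h x M.succ.succ N.succ.succ) : Tens O h where
  ord := ho
  der := by
    have key : ∀ μ α β, (μ : Fin (n + 3)) ≠ 1 →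
        Van O (ordH (cls α) (cls β)) (dW μ fun x => h x α β) :=
      fun μ α β hμ => (ho α β).dW_tangent hO hμ
    refine index_cases ?_ ?_ ?_
    · intro α β
      by_cases hc : cls α = 2 ∧ cls β = 2
      · obtain ⟨h1, h2⟩ := hc
        cases α using index_cases with
        | h0 => simp at h1
        | h1 => simp at h1
        | h2 M =>
          cases β using index_cases with
          | h0 => simp at h2
          | h1 => simp at h2
          | h2 N => exact (ht M N).2
      · exact (key 0 α β (by simp)).mono
          ((show ∀ a b : Fin 3, ¬ (a = 2 ∧ b = 2) → ordDH 0 a b ≤ ordH a b by decide) _ _ hc)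
    · intro α β
      exact ((ho α β).dW_rho).mono ((show ∀ a b : Fin 3, ordDH 1 a b ≤ ordH a b - 1 by decide) _ _)
    · intro M α β
      exact (key _ α β (succ_ne_one M)).mono
        ((show ∀ a b : Fin 3, ordDH 2 a b ≤ ordH a b by decide) _ _)

lemma Metr.tvan (hg : Metr κ O g) (α β : Fin (n + 3)) : TVan O fun x => g x α β := by
  refine ⟨(hg.ord α β).sm, (hg.der 0 α β).mono ?_⟩
  exact (show ∀ a b : Fin 3, 1 ≤ ordDG 0 a b by decide) _ _

/-- The orders of the derivatives exceed what differentiation of `ordG` gives in only three places: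
tangential derivatives of `g_tt` and of `g_ρρ`, whose leading parts `-κ² ρ²` and `1` are constant
along the horizon directions, and `∂_t` of the cross-section block, supplied by `ht`. -/
lemma Metr.mk' (hO : IsOpen O) (ho : ∀ α β, Van O (ordG (cls α) (cls β)) (fun x => g x α β))
    (htt : Van O 3 fun x => g x 0 0 + κ ^ 2 * x 1 ^ 2)
    (hrr : Van O 1 fun x => g x 1 1 - 1)
    (ht : ∀ M N : Fin (n + 1), TVan O fun x => g x M.succ.succ N.succ.succ)
    (hnd : ∀ p ∈ O, p 1 = 0 →
      (Matrix.of fun M N : Fin (n + 1) => g p M.succ.succ N.succ.succ).det ≠ 0) :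
    Metr κ O g where
  ord := ho
  tt := htt
  rr := hrr
  nondeg := hnd
  der := by
    have key : ∀ μ α β, (μ : Fin (n + 3)) ≠ 1 →
        Van O (ordG (cls α) (cls β)) (dW μ fun x => g x α β) :=
      fun μ α β hμ => (ho α β).dW_tangent hO hμ
    have key0 : ∀ μ, (μ : Fin (n + 3)) ≠ 1 → Van O 3 (dW μ fun x => g x 0 0) := by
      intro μ hμ
      refine ((htt.dW_tangent hO hμ).add hO (Van.neg hO (k := 3) ?_)).congr hO (g := _)
        (f := fun x => dW μ (fun x => g x 0 0 + κ ^ 2 * x 1 ^ 2) x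
          + -dW μ (fun x => κ ^ 2 * x 1 ^ 2) x) fun x hx hx' => ?_
      · refine Van.congr hO van_zero_fun fun x hx hx' => ?_
        have hs : Sm O fun x : Coord n => x 1 * x 1 := (sm_coord 1).mul (sm_coord 1)
        simp only [pow_two (_ : ℝ)]
        rw [dW_mul (sm_const _) hs μ hx hx', dW_const, dW_mul (sm_coord 1) (sm_coord 1) μ hx hx',
          dW_coord μ 1 hx', if_neg hμ.symm]
        ring
      · rw [dW_add (ho 0 0).sm ((van_rho_pow hO (k := 2)).const_mul hO (κ ^ 2)).sm μ hx hx']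
        ring
    have key1 : ∀ μ, (μ : Fin (n + 3)) ≠ 1 → Van O 1 (dW μ fun x => g x 1 1) := by
      intro μ hμ
      refine (hrr.dW_tangent hO hμ).congr hO fun x hx hx' => ?_
      simp only [sub_eq_add_neg]
      rw [dW_add (ho 1 1).sm (sm_const _) μ hx hx', dW_const, add_zero]
    have t1 : ∀ m a b : Fin 3, m ≠ 1 → ¬ (a = 0 ∧ b = 0) → ¬ (a = 1 ∧ b = 1) →
      ¬ (m = 0 ∧ a = 2 ∧ b = 2) → ordDG m a b ≤ ordG a b := by decide
    intro μ α β
    by_cases hμ : μ = 1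
    · subst hμ
      exact ((ho α β).dW_rho).mono ((show ∀ a b : Fin 3, ordDG 1 a b ≤ ordG a b - 1 by decide) _ _)
    have hcμ : cls μ ≠ 1 := by
      cases μ using index_cases with
      | h0 => simp
      | h1 => exact absurd rfl hμ
      | h2 M => simp
    by_cases h0 : α = 0 ∧ β = 0
    · obtain ⟨rfl, rfl⟩ := h0
      exact (key0 μ hμ).mono ((show ∀ m : Fin 3, ordDG m 0 0 ≤ 3 by decide) _)
    by_cases h1 : α = 1 ∧ β = 1
    · obtain ⟨rfl, rfl⟩ := h1
      exact (key1 μ hμ).mono ((show ∀ m : Fin 3, m ≠ 1 → ordDG m 1 1 ≤ 1 by decide) _ hcμ)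
    by_cases h2 : μ = 0 ∧ cls α = 2 ∧ cls β = 2
    · obtain ⟨rfl, h3, h4⟩ := h2
      cases α using index_cases with
      | h0 => simp at h3
      | h1 => simp at h3
      | h2 M =>
        cases β using index_cases with
        | h0 => simp at h4
        | h1 => simp at h4
        | h2 N => exact (ht M N).2
    · refine (key μ α β hμ).mono (t1 _ _ _ hcμ ?_ ?_ ?_)
      · rwa [cls_eq_zero, cls_eq_zero]
      · rwa [cls_eq_one, cls_eq_one]
      · rwa [cls_eq_zero]

/-- Lie derivatives of the metric are variations of the metric. -/
lemma Metr.lieW (hO : IsOpen O) (hg : Metr κ O g) (hξ : VecF O ξ) : Tens O (lieW ξ g) := by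
  -- One table check for each of the three products in the Lie derivative.
  have t1 : ∀ a m v : Fin 3, ordH m v ≤ ordV a + ordDG a m v := by decide
  have t2 : ∀ a m v : Fin 3, ordH m v ≤ ordG a v + ordDV m a := by decide
  have t3 : ∀ a m v : Fin 3, ordH m v ≤ ordG m a + ordDV v a := by decide
  refine Tens.mk' hO (fun μ ν => Van.sum hO _ fun α _ => ?_)
    fun M N => TVan.sum hO _ fun α _ => ?_
  · exact ((((hξ.val α).mul hO (hg.der α μ ν)).mono (t1 _ _ _)).add hO
      (((hg.ord α ν).mul hO (hξ.der μ α)).mono (t2 _ _ _))).add hO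
      (((hg.ord μ α).mul hO (hξ.der ν α)).mono (t3 _ _ _))
  · have h1 : ∀ P : Fin (n + 1), TVan O (dW P.succ.succ fun y => ξ y α) := fun P =>
      (hξ.tvan α).dW_tangent hO (succ_ne_one P)
    refine TVan.add hO (TVan.add hO ?_ ((hg.tvan _ _).mul hO (h1 M)))
      ((hg.tvan _ _).mul hO (h1 N))
    -- `TVan` is not stable under `∂_ρ`, so the term `ξ^ρ ∂_ρ g_{MN}` is treated apart; there `ξ^ρ =
    -- O(ρ²)` suffices.
    by_cases hα : α = 1
    · subst hα
      exact ((hξ.val 1).mul hO (hg.der 1 M.succ.succ N.succ.succ)).tvan hO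
        (show 1 ≤ ordV 1 + ordDG 1 2 2 by decide)
    · exact (hξ.tvan α).mul hO ((hg.tvan _ _).dW_tangent hO hα)

/-- `∂_t ∂_M φ^α = ∂_M ∂_t φ^α`, and `∂_t φ^α` is constant on the horizon: `1` for `α = t` and `0`
otherwise. -/
lemma MapF.jac_tvan (hO : IsOpen O) (hφ : MapF O O' φ) (M : Fin (n + 1)) (α : Fin (n + 3)) :
    TVan O (dW M.succ.succ fun x => φ x α) := by
  refine ⟨(hφ.sm α).deriv _, Van.congr hO ?_
    fun x hx hx' => dW_comm (hφ.sm α) 0 M.succ.succ hx hx'⟩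
  by_cases hα : α = 0
  · subst hα
    refine (hφ.tt.dW_tangent hO (succ_ne_one M)).congr hO fun x hx hx' => ?_
    simp only [sub_eq_add_neg]
    rw [dW_add ((hφ.sm 0).deriv 0) (sm_const _) _ hx hx', dW_const, add_zero]
  · refine ((hφ.jac 0 α).dW_tangent hO (succ_ne_one M)).mono ?_
    exact (show ∀ a : Fin 3, a ≠ 0 → 1 ≤ ordJ 0 a by decide) _ (by rwa [Ne, cls_eq_zero])

/-- In the chain rule for `∂_t`, the term with `∂_t f` vanishes at the horizon by hypothesis, the
others because `∂_t φ^α` does for `α ≠ t`. -/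
lemma MapF.comp_tvan (hO : IsOpen O) (hO' : IsOpen O') (hφ : MapF O O' φ) {f : Coord n → ℝ}
    (hf : TVan O' f) : TVan O fun x => f (φ x) := by
  refine ⟨hf.1.comp hO hφ.sm hφ.maps, Van.congr hO (Van.sum hO Finset.univ
    (F := fun α x => dW α f (φ x) * dW 0 (fun y => φ y α) x) fun α _ => ?_)
    fun x hx hx' => dW_comp hO hφ.sm hφ.maps hf.1 0 hx hx'⟩
  by_cases hα : α = 0
  · subst hα
    exact (hf.2.comp hO hO' hφ.sm hφ.maps hφ.horizon).mul hO (l := 0) ((hφ.sm 0).deriv 0)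
  · have h1 : Van O 0 fun x => dW α f (φ x) := (hf.1.deriv α).comp hO hφ.sm hφ.maps
    refine (h1.mul hO (hφ.jac 0 α)).mono ?_
    exact (show ∀ a : Fin 3, a ≠ 0 → 1 ≤ 0 + ordJ 0 a by decide) _ (by rwa [Ne, cls_eq_zero])

/-- Pull-backs of metrics by the diffeomorphisms keep their asymptotics. -/
lemma Metr.pullW (hO : IsOpen O) (hO' : IsOpen O') (hg : Metr κ O' g) (hφ : MapF O O' φ) :
    Metr κ O (pullW φ g) := by
  have hc : ∀ {k : ℕ} {f : Coord n → ℝ}, Van O' k f → Van O k fun x => f (φ x) :=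
    fun hf => hf.comp hO hO' hφ.sm hφ.maps hφ.horizon
  have hV : ∀ μ ν α β, Van O (ordG (cls α) (cls β) + ordJ (cls μ) (cls α) + ordJ (cls ν) (cls β))
      (fun x => g (φ x) α β * dW μ (fun y => φ y α) x * dW ν (fun y => φ y β) x) :=
    fun μ ν α β => ((hc (hg.ord α β)).mul hO (hφ.jac μ α)).mul hO (hφ.jac ν β)
  refine Metr.mk' hO (fun μ ν => Van.sum hO _ fun α _ => Van.sum hO _ fun β _ => ?_) ?_ ?_
    (fun M N => TVan.sum hO _ fun α _ => TVan.sum hO _ fun β _ => ?_) fun p hp hp1 => ?_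
  · exact (hV μ ν α β).mono ((show ∀ a b m v : Fin 3, ordG m v ≤ ordG a b + ordJ m a + ordJ v b by
      decide) _ _ _ _)
  -- The counterterm `κ² ρ²` is attached to the single summand `α = β = 0`; all other summands are
  -- already of order `3`.
  · refine Van.congr hO (Van.sum hO Finset.univ (F := fun α x => ∑ β : Fin (n + 3),
      (g (φ x) α β * dW 0 (fun y => φ y α) x * dW 0 (fun y => φ y β) x
        + if α = 0 then if β = 0 then κ ^ 2 * x 1 ^ 2 else 0 else 0))
      fun α _ => Van.sum hO _ fun β _ => ?_) fun x hx hx' => ?_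
    · by_cases h0 : α = 0 ∧ β = 0
      · obtain ⟨rfl, rfl⟩ := h0
        simp only [if_true]
        have hJ : Van O 0 (dW 0 fun y => φ y 0) := (hφ.sm 0).deriv 0
        -- With `J = ∂_t φ^t`, the summand `J² g_tt(φ) + κ² ρ²` telescopes into `J² (g_tt(φ) + κ²
        -- (φ^ρ)²)`, `-κ² J² ((φ^ρ)² - ρ²)` and `-κ² (J² - 1) ρ²`. Each is of order `3`, by `hg.tt`,
        -- `hφ.rho` and `hφ.tt` respectively.
        have h1 := ((hc hg.tt).mul hO hJ).mul hO hJ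
        have h2 : Van O 1 fun x => φ x 1 + x 1 :=
          (van_one (hφ.sm 1) hφ.horizon).add hO van_rho
        have h3 := ((((hφ.rho.mul hO h2).mul hO hJ).mul hO hJ).const_mul hO (κ ^ 2)).neg hO
        have h4 := (((hφ.tt.mul hO (l := 0) (hJ.add hO (sm_const (1 : ℝ)))).mul hO
          (van_rho_pow hO (k := 2))).const_mul hO (κ ^ 2)).neg hO
        refine ((h1.add hO h3).add hO h4).congr hO fun x hx hx' => ?_
        ring
      · have e : ∀ x : Coord n, (if α = 0 then if β = 0 then κ ^ 2 * x 1 ^ 2 else 0 else 0) = 0 := by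
          intro x
          split_ifs with h1 h2
          · exact absurd ⟨h1, h2⟩ h0
          · rfl
          · rfl
        simp only [e, add_zero]
        refine (hV 0 0 α β).mono ((show ∀ a b : Fin 3, ¬ (a = 0 ∧ b = 0) →
          3 ≤ ordG a b + ordJ 0 a + ordJ 0 b by decide) _ _ ?_)
        rwa [cls_eq_zero, cls_eq_zero]
    · simp [Finset.sum_add_distrib, KillingHorizon.pullW]
  · refine Van.congr hO (Van.sum hO Finset.univ (F := fun α x => ∑ β : Fin (n + 3),
      (g (φ x) α β * dW 1 (fun y => φ y α) x * dW 1 (fun y => φ y β) x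
        + if α = 1 then if β = 1 then -1 else 0 else 0))
      fun α _ => Van.sum hO _ fun β _ => ?_) fun x hx hx' => ?_
    · by_cases h0 : α = 1 ∧ β = 1
      · obtain ⟨rfl, rfl⟩ := h0
        simp only [if_true]
        have hJ : Van O 0 (dW 1 fun y => φ y 1) := (hφ.sm 1).deriv 1
        have h1 := ((hc hg.rr).mul hO hJ).mul hO hJ
        have h2 := hφ.rr.mul hO (l := 0) (hJ.add hO (sm_const (1 : ℝ)))
        refine (h1.add hO h2).congr hO fun x hx hx' => ?_
        ring
      · have e : (if α = 1 then if β = 1 then (-1 : ℝ) else 0 else 0) = 0 := by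
          split_ifs with h1 h2
          · exact absurd ⟨h1, h2⟩ h0
          · rfl
          · rfl
        simp only [e, add_zero]
        refine (hV 1 1 α β).mono ((show ∀ a b : Fin 3, ¬ (a = 1 ∧ b = 1) →
          1 ≤ ordG a b + ordJ 1 a + ordJ 1 b by decide) _ _ ?_)
        rwa [cls_eq_one, cls_eq_one]
    · simp [Finset.sum_add_distrib, KillingHorizon.pullW, sub_eq_add_neg]
  · exact ((hφ.comp_tvan hO hO' (hg.tvan α β)).mul hO (hφ.jac_tvan hO M α)).mul hO
      (hφ.jac_tvan hO N β)
  · set J : Matrix (Fin (n + 1)) (Fin (n + 1)) ℝ :=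
      Matrix.of fun M N => dW M.succ.succ (fun x => φ x N.succ.succ) p with hJ
    set γ : Matrix (Fin (n + 1)) (Fin (n + 1)) ℝ :=
      Matrix.of fun M N => g (φ p) M.succ.succ N.succ.succ with hγ
    -- At `ρ = 0` only the cross-section block contributes, so the induced metric changes by a
    -- congruence with the Jacobian `J`.
    have e : (Matrix.of fun M N : Fin (n + 1) =>
        KillingHorizon.pullW φ g p M.succ.succ N.succ.succ) = J * γ * J.transpose := by
      ext M N
      have hz : ∀ α β, ¬ (cls α = 2 ∧ cls β = 2) → g (φ p) α β *
          dW M.succ.succ (fun y => φ y α) p * dW N.succ.succ (fun y => φ y β) p = 0 := by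
        intro α β hαβ
        exact ((hV M.succ.succ N.succ.succ α β).mono (l := 1) ((show ∀ a b : Fin 3,
          ¬ (a = 2 ∧ b = 2) → 1 ≤ ordG a b + ordJ 2 a + ordJ 2 b by decide) _ _ hαβ)).zero_of hp hp1
      simp only [Matrix.of_apply, KillingHorizon.pullW, Matrix.mul_apply, Matrix.transpose_apply,
        Finset.sum_mul]
      rw [Finset.sum_comm (γ := Fin (n + 1))]
      rw [sum_cross fun α hα => Finset.sum_eq_zero fun β _ => hz α β fun h => hα h.1]
      refine Finset.sum_congr rfl fun P _ => ?_
      rw [sum_cross fun β hβ => hz _ β fun h => hβ h.2]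
      refine Finset.sum_congr rfl fun Q _ => ?_
      simp only [hJ, hγ, Matrix.of_apply]
      ring
    rw [e, Matrix.det_mul, Matrix.det_mul, Matrix.det_transpose]
    have h1 := hφ.nondeg p hp hp1
    have h2 := hg.nondeg _ (hφ.maps p hp hp1.ge).1 (hφ.horizon p hp hp1)
    exact mul_ne_zero (mul_ne_zero h1 h2) h1

end classes

/-! ### The pre-symplectic current near the horizon -/

/-- The weight of an index: each lower index `t` carries a factor `ρ`. -/
def wt : Fin 3 → ℤ := ![1, 0, 0]

/-- Orders of the components of the inverse metric. -/
def ordI : Fin 3 → Fin 3 → ℤ := ![![-2, -1, -1], ![-1, 0, 0], ![0, 1, 0]]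

/-- Orders of the Christoffel symbols `Γ^α_{μν}`. -/
def ordC (α μ ν : Fin 3) : ℤ := wt μ + wt ν - wt α + if α = 2 then 0 else -1

/-- The metric in the frame `ρ dt, dρ, dx^M`. -/
def frameMetric (g : Tensor2 n) (x : Coord n) : Matrix (Fin (n + 3)) (Fin (n + 3)) ℝ :=
  Matrix.of fun μ ν => x 1 ^ (-wt (cls μ)) * g x μ ν * x 1 ^ (-wt (cls ν))

/-- The limit at the horizon point `p` of the metric in the frame `ρ dt, dρ, dx^M`. -/
def frameLimit (κ : ℝ) (g : Tensor2 n) (p : Coord n) : Matrix (Fin (n + 3)) (Fin (n + 3)) ℝ :=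
  Matrix.of fun μ ν => if cls μ = 2 ∧ cls ν = 2 then g p μ ν else
    if μ = 0 ∧ ν = 0 then -κ ^ 2 else if μ = 1 ∧ ν = 1 then 1 else 0

section
variable {O : Set (Coord n)} {g : Tensor2 n} {κ : ℝ} {p : Coord n}

/-- The limit is block diagonal with blocks `-κ²`, `1` and the cross-section metric, so a kernel
vector vanishes block by block. -/
lemma Metr.frameLimit_det (hg : Metr κ O g) (hκ : κ ≠ 0) (hp : p ∈ O) (hp1 : p 1 = 0) :
    (frameLimit κ g p).det ≠ 0 := by
  intro h
  obtain ⟨v, hv, h0⟩ := Matrix.exists_mulVec_eq_zero_iff.2 h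
  have hrow : ∀ μ, ∑ ν, frameLimit κ g p μ ν * v ν = 0 := fun μ => congrFun h0 μ
  have v0 : v 0 = 0 := by
    have := hrow 0
    rw [sum_index] at this
    simpa [frameLimit, hκ] using this
  have v1 : v 1 = 0 := by
    have := hrow 1
    rw [sum_index] at this
    simpa [frameLimit, succ_ne_one] using this
  have v2 : (fun M : Fin (n + 1) => v M.succ.succ) = 0 := by
    refine Matrix.eq_zero_of_mulVec_eq_zero (hg.nondeg p hp hp1) (funext fun M => ?_)
    have := hrow M.succ.succ
    rw [sum_index, v0, v1] at this
    simpa [frameLimit, Matrix.mulVec, dotProduct] using this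
  refine hv (funext fun μ => ?_)
  cases μ using index_cases with
  | h0 => exact v0
  | h1 => exact v1
  | h2 M => exact congrFun v2 M

lemma Metr.bd_frame (hO : IsOpen O) (hg : Metr κ O g) (hp : p ∈ O) (hp1 : p 1 = 0)
    (μ ν : Fin (n + 3)) : Bd p (ordG (cls μ) (cls ν) - wt (cls μ) - wt (cls ν))
      fun x => frameMetric g x μ ν := by
  have := ((bd_rho_zpow (p := p) (k := -wt (cls μ))).mul ((hg.ord μ ν).bd hO hp hp1)).mul
    (bd_rho_zpow (k := -wt (cls ν)))
  exact this.mono hp1 (by omega)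

lemma Metr.bd_frame_offdiag (hO : IsOpen O) (hg : Metr κ O g) (hp : p ∈ O) (hp1 : p 1 = 0)
    {μ ν : Fin (n + 3)} (h : μ ≠ ν) (h2 : ¬ (cls μ = 2 ∧ cls ν = 2)) :
    Bd p 1 fun x => frameMetric g x μ ν := by
  refine (hg.bd_frame hO hp hp1 μ ν).mono hp1 ?_
  refine (show ∀ a b : Fin 3, ¬ (a = 2 ∧ b = 2) → a ≠ b → 1 ≤ (ordG a b : ℤ) - wt a - wt b by
    decide) _ _ h2 fun hc => ?_
  cases μ using index_cases with
  | h0 => exact h ((cls_eq_zero.1 hc.symm).symm)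
  | h1 => exact h ((cls_eq_one.1 hc.symm).symm)
  | h2 M => exact h2 ⟨rfl, hc.symm⟩

lemma Metr.tendsto_frame (hO : IsOpen O) (hg : Metr κ O g) (hp : p ∈ O) (hp1 : p 1 = 0) :
    Tendsto (frameMetric g) (𝓝[pos n] p) (𝓝 (frameLimit κ g p)) := by
  refine tendsto_pi_nhds.2 fun μ => tendsto_pi_nhds.2 fun ν => ?_
  by_cases h2 : cls μ = 2 ∧ cls ν = 2
  · have := (hg.ord μ ν).sm.tendsto hp hp1
    simpa [frameMetric, frameLimit, h2, wt] using this
  by_cases h : μ = ν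
  · subst h
    cases μ using index_cases with
    | h0 =>
      have h1 : Bd p 1 fun x => x 1 ^ (-2 : ℤ) * (g x 0 0 + κ ^ 2 * x 1 ^ 2) :=
        (bd_rho_zpow.mul (hg.tt.bd hO hp hp1)).mono hp1 (by norm_num)
      have h3 := (h1.tendsto_zero hp1).add_const (-κ ^ 2)
      rw [zero_add] at h3
      simp only [frameLimit, Matrix.of_apply, cls_zero]
      refine (h3.congr' ?_)
      filter_upwards [eventually_pos] with x hx
      simp only [frameMetric, Matrix.of_apply, cls_zero, wt, Matrix.cons_val_zero]
      have : x 1 ≠ 0 := hx.ne'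
      rw [zpow_neg, zpow_neg, zpow_one, zpow_ofNat]
      field_simp
      ring
    | h1 =>
      have h3 := ((hg.rr.bd hO hp hp1).tendsto_zero hp1).add_const 1
      simpa [frameMetric, frameLimit, wt] using h3
    | h2 M => exact absurd ⟨rfl, rfl⟩ h2
  · have h3 := (hg.bd_frame_offdiag hO hp hp1 h h2).tendsto_zero hp1
    have e : frameLimit κ g p μ ν = 0 := by
      simp only [frameLimit, Matrix.of_apply]
      rw [if_neg h2, if_neg (fun h4 => h (h4.1.trans h4.2.symm)),
        if_neg (fun h4 => h (h4.1.trans h4.2.symm))]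
    rwa [e]

lemma frameMetric_spec {x : Coord n} (hx : 0 < x 1) (μ ν : Fin (n + 3)) :
    g x μ ν = x 1 ^ wt (cls μ) * frameMetric g x μ ν * x 1 ^ wt (cls ν) := by
  have h1 := (zpow_pos hx (wt (cls μ))).ne'
  have h2 := (zpow_pos hx (wt (cls ν))).ne'
  simp only [frameMetric, Matrix.of_apply, zpow_neg]
  field_simp

/-- In the frame the inverse is bounded because the limit is invertible. The entries with row `x^M`
and column `t` or `ρ` gain one more power, since those columns of the frame metric are `O(ρ)` off
the diagonal. `Γ^M` needs this gain. -/
lemma Metr.bd_inv (hO : IsOpen O) (hg : Metr κ O g) (hκ : κ ≠ 0) (hp : p ∈ O) (hp1 : p 1 = 0)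
    (μ ν : Fin (n + 3)) : Bd p (ordI (cls μ) (cls ν)) fun x => (g x)⁻¹ μ ν := by
  have hT := hg.tendsto_frame hO hp hp1
  have h0 := hg.frameLimit_det hκ hp hp1
  have hI := tendsto_inv_matrix hT h0
  have hb : ∀ μ ν, Bd p 0 fun x => (frameMetric g x)⁻¹ μ ν := fun μ ν =>
    bd_of_tendsto (((tendsto_pi_nhds.1 ((tendsto_pi_nhds.1 hI) μ)) ν))
  have hdet : ∀ᶠ x in 𝓝[pos n] p, (frameMetric g x).det ≠ 0 :=
    (((Continuous.matrix_det continuous_id).tendsto _).comp hT).eventually_ne h0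
  have hlift : ∀ {k : ℤ}, Bd p k (fun x => (frameMetric g x)⁻¹ μ ν) →
      Bd p (-wt (cls μ) + k + -wt (cls ν)) fun x => (g x)⁻¹ μ ν := by
    intro k hk
    refine ((bd_rho_zpow.mul hk).mul bd_rho_zpow).congr ?_
    filter_upwards [eventually_pos] with x hx
    rw [inv_conj_diagonal (A := g x) (B := frameMetric g x) (fun i => (zpow_pos hx (wt (cls i))).ne')
      fun i j => frameMetric_spec hx i j, zpow_neg, zpow_neg]
  by_cases hc : cls μ = 2 ∧ cls ν ≠ 2
  · have hne : μ ≠ ν := by rintro rfl; exact hc.2 hc.1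
    have hd : ∃ a : ℝ, a ≠ 0 ∧ Tendsto (fun x => frameMetric g x ν ν) (𝓝[pos n] p) (𝓝 a) := by
      refine ⟨frameLimit κ g p ν ν, ?_, (tendsto_pi_nhds.1 ((tendsto_pi_nhds.1 hT) ν)) ν⟩
      cases ν using index_cases with
      | h0 => simpa [frameLimit] using hκ
      | h1 => simp [frameLimit]
      | h2 M => simp at hc
    obtain ⟨a, ha, hta⟩ := hd
    refine (hlift (bd_inv_offdiag hp1 hb hdet (fun i hi =>
      hg.bd_frame_offdiag hO hp hp1 hi fun h => hc.2 h.2) ha hta hne)).mono hp1 ?_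
    exact (show ∀ a b : Fin 3, a = 2 ∧ b ≠ 2 → ordI a b ≤ -wt a + 1 + -wt b by decide) _ _ hc
  · refine (hlift (hb μ ν)).mono hp1 ?_
    exact (show ∀ a b : Fin 3, ¬ (a = 2 ∧ b ≠ 2) → ordI a b ≤ -wt a + 0 + -wt b by decide) _ _ hc

lemma det_eq_frame {x : Coord n} (hx : 0 < x 1) :
    (g x).det = x 1 ^ 2 * (frameMetric g x).det := by
  have e : g x = Matrix.diagonal (fun i => x 1 ^ wt (cls i)) * frameMetric g x *
      Matrix.diagonal (fun i => x 1 ^ wt (cls i)) := by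
    ext i j
    rw [Matrix.mul_diagonal, Matrix.diagonal_mul]
    exact frameMetric_spec hx i j
  have hd : ∏ i : Fin (n + 3), x 1 ^ wt (cls i) = x 1 := by
    rw [Fin.prod_univ_succ, Finset.prod_eq_one]
    · simp [wt]
    · intro i _
      have : cls i.succ ≠ 0 := fun h => Fin.succ_ne_zero i (cls_eq_zero.1 h)
      rw [(show ∀ a : Fin 3, a ≠ 0 → wt a = 0 by decide) _ this, zpow_zero]
  conv_lhs => rw [e]
  rw [Matrix.det_mul, Matrix.det_mul, Matrix.det_diagonal, hd]
  ring

lemma Metr.eventually_det (hO : IsOpen O) (hg : Metr κ O g) (hκ : κ ≠ 0) (hp : p ∈ O)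
    (hp1 : p 1 = 0) : ∀ᶠ x in 𝓝[pos n] p, (g x).det ≠ 0 := by
  have := (((Continuous.matrix_det continuous_id).tendsto _).comp
    (hg.tendsto_frame hO hp hp1)).eventually_ne (hg.frameLimit_det hκ hp hp1)
  filter_upwards [this, eventually_pos] with x h hx
  rw [det_eq_frame hx]
  exact mul_ne_zero (pow_ne_zero 2 hx.ne') h

lemma Metr.bd_sqrt (hO : IsOpen O) (hg : Metr κ O g) (hp : p ∈ O)
    (hp1 : p 1 = 0) : Bd p 1 fun x => Real.sqrt (-(g x).det) := by
  have h1 : Tendsto (fun x => Real.sqrt (-(frameMetric g x).det)) (𝓝[pos n] p)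
      (𝓝 (Real.sqrt (-(frameLimit κ g p).det))) :=
    ((Real.continuous_sqrt.comp (Continuous.matrix_det continuous_id).neg).tendsto _).comp
      (hg.tendsto_frame hO hp hp1)
  refine (((bd_rho_zpow (p := p) (k := 1)).mul (bd_of_tendsto h1)).mono hp1 (by simp)).congr ?_
  filter_upwards [eventually_pos] with x hx
  rw [det_eq_frame hx, ← mul_neg, Real.sqrt_mul (sq_nonneg _), Real.sqrt_sq hx.le, zpow_one]

lemma Van.bd_pd (hO : IsOpen O) (hp : p ∈ O) (hp1 : p 1 = 0) {k : ℕ} {μ : Fin (n + 3)}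
    {f : Coord n → ℝ} (h : Van O k (dW μ f)) : Bd p k (pd μ f) := by
  refine (h.bd hO hp hp1).congr ?_
  filter_upwards [eventually_pos] with x hx
  exact pd_eq_dW hx

/-- A derivative `∂_ρ` costs one power of `ρ` against the weights, which `ordC` concedes to `Γ^t`
and `Γ^ρ`. In `Γ^M` the summands with `β` equal to `t` or `ρ` are compensated by the gain in the
inverse metric; for `β` along the cross-section the derivatives already have the weighted order,
thanks to `∂_t g_{MN} = O(ρ)`. -/
lemma Metr.bd_christoffel (hO : IsOpen O) (hg : Metr κ O g) (hκ : κ ≠ 0) (hp : p ∈ O)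
    (hp1 : p 1 = 0) (α μ ν : Fin (n + 3)) :
    Bd p (ordC (cls α) (cls μ) (cls ν)) (christoffel g α μ ν) := by
  have hI := hg.bd_inv hO hκ hp hp1 α
  have hD : ∀ μ α β, Bd p (ordDG (cls μ) (cls α) (cls β)) (pd μ fun y => g y α β) :=
    fun μ α β => (hg.der μ α β).bd_pd hO hp hp1
  refine Bd.const_mul (Bd.sum _ fun β _ => ?_) _
  have h1 := ((hI β).mul (hD μ β ν)).mono hp1 ((show ∀ a b m v : Fin 3,
    ordC a m v ≤ ordI a b + ordDG m b v by decide) (cls α) _ (cls μ) (cls ν))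
  have h2 := ((hI β).mul (hD ν β μ)).mono hp1 ((show ∀ a b m v : Fin 3,
    ordC a m v ≤ ordI a b + ordDG v b m by decide) (cls α) _ (cls μ) (cls ν))
  have h3 := ((hI β).mul (hD β μ ν)).mono hp1 ((show ∀ a b m v : Fin 3,
    ordC a m v ≤ ordI a b + ordDG b m v by decide) (cls α) _ (cls μ) (cls ν))
  refine ((h1.add h2).sub h3).congr (Eventually.of_forall fun x => ?_)
  simp only
  ring

/-- No power is lost: the factor `ρ⁻¹` in `Γ^δ` occurs only for `δ` equal to `t` or `ρ`, and then
`h_{δβ}` is one power smaller than its weight. -/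
lemma Metr.bd_covDeriv (hO : IsOpen O) (hg : Metr κ O g) (hκ : κ ≠ 0) (hp : p ∈ O)
    (hp1 : p 1 = 0) {h : Tensor2 n} (hh : Tens O h) (γ α β : Fin (n + 3)) :
    Bd p (wt (cls γ) + wt (cls α) + wt (cls β)) (covDeriv g h γ α β) := by
  have hC := hg.bd_christoffel hO hκ hp hp1
  have hH : ∀ α β, Bd p (ordH (cls α) (cls β)) (fun x => h x α β) :=
    fun α β => (hh.ord α β).bd hO hp hp1
  refine Bd.sub (((hh.der γ α β).bd_pd hO hp hp1).mono hp1 ?_)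
    (Bd.sum _ fun δ _ => Bd.add (((hC δ γ α).mul (hH δ β)).mono hp1 ?_)
      (((hC δ γ β).mul (hH α δ)).mono hp1 ?_))
  · exact (show ∀ c a b : Fin 3, wt c + wt a + wt b ≤ ordDH c a b by decide) _ _ _
  · exact (show ∀ c a b d : Fin 3, wt c + wt a + wt b ≤ ordC d c a + ordH d b by decide) _ _ _ _
  · exact (show ∀ c a b d : Fin 3, wt c + wt a + wt b ≤ ordC d c b + ordH a d by decide) _ _ _ _

/-- The current is `O(ρ)`, and its component `ω^t` is `O(1)`. -/
lemma Metr.bd_current (hO : IsOpen O) (hg : Metr κ O g) (hκ : κ ≠ 0) (hp : p ∈ O)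
    (hp1 : p 1 = 0) (G : ℝ) {h₁ h₂ : Tensor2 n} (hh₁ : Tens O h₁) (hh₂ : Tens O h₂)
    (ν : Fin (n + 3)) : Bd p (1 - wt (cls ν)) (presymplecticCurrent G g h₁ h₂ ν) := by
  have hI : ∀ α β, Bd p (-wt (cls α) - wt (cls β)) fun x => (g x)⁻¹ α β := fun α β =>
    (hg.bd_inv hO hκ hp hp1 α β).mono hp1
      ((show ∀ a b : Fin 3, -wt a - wt b ≤ ordI a b by decide) _ _)
  have hH : ∀ {h : Tensor2 n}, Tens O h → ∀ α β, Bd p (wt (cls α) + wt (cls β)) fun x => h x α β :=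
    fun hh α β => ((hh.ord α β).bd hO hp hp1).mono hp1
      ((show ∀ a b : Fin 3, wt a + wt b ≤ ordH a b by decide) _ _)
  have hD₁ := hg.bd_covDeriv hO hκ hp hp1 hh₁
  have hD₂ := hg.bd_covDeriv hO hκ hp hp1 hh₂
  -- Each of the five summed indices occurs once up and once down, so its weight cancels; only the
  -- free upper index `ν` remains. The last factor `ρ` comes from `√(-g)`.
  have key : Bd p (-wt (cls ν)) fun x => ∑ r, ∑ s, ∑ c, ∑ a, ∑ b,
      ((g x)⁻¹ ν a * ((g x)⁻¹ r s * (g x)⁻¹ b c - 2 * (g x)⁻¹ r b * (g x)⁻¹ s c)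
        + 2 * (g x)⁻¹ ν c
          * ((1 / 2) * ((g x)⁻¹ r a * (g x)⁻¹ s b - (g x)⁻¹ r s * (g x)⁻¹ a b))
        + (g x)⁻¹ ν r * (g x)⁻¹ a b * (g x)⁻¹ s c)
      * ((1 / 2) * (h₁ x r s * covDeriv g h₂ c a b x - h₂ x r s * covDeriv g h₁ c a b x)) := by
    refine Bd.sum _ fun r _ => Bd.sum _ fun s _ => Bd.sum _ fun c _ => Bd.sum _ fun a _ =>
      Bd.sum _ fun b _ => ?_
    have hA : Bd p (-wt (cls ν) - wt (cls r) - wt (cls s) - wt (cls c) - wt (cls a) - wt (cls b))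
        fun x => ((g x)⁻¹ ν a * ((g x)⁻¹ r s * (g x)⁻¹ b c - 2 * (g x)⁻¹ r b * (g x)⁻¹ s c)
        + 2 * (g x)⁻¹ ν c
          * ((1 / 2) * ((g x)⁻¹ r a * (g x)⁻¹ s b - (g x)⁻¹ r s * (g x)⁻¹ a b))
        + (g x)⁻¹ ν r * (g x)⁻¹ a b * (g x)⁻¹ s c) := by
      refine Bd.add (Bd.add ?_ ?_) ?_
      · exact ((hI ν a).mul ((((hI r s).mul (hI b c)).mono hp1 (l := -wt (cls r) - wt (cls s)
          - wt (cls b) - wt (cls c)) (by omega)).sub ((((hI r b).const_mul 2).mul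
          (hI s c)).mono hp1 (by omega)))).mono hp1 (by omega)
      · exact (((hI ν c).const_mul 2).mul (Bd.const_mul ((((hI r a).mul (hI s b)).mono hp1
          (l := -wt (cls r) - wt (cls s) - wt (cls a) - wt (cls b)) (by omega)).sub
          (((hI r s).mul (hI a b)).mono hp1 (by omega))) _)).mono hp1 (by omega)
      · exact (((hI ν r).mul (hI a b)).mul (hI s c)).mono hp1 (by omega)
    have hB : Bd p (wt (cls r) + wt (cls s) + wt (cls c) + wt (cls a) + wt (cls b))
        fun x => (1 / 2) * (h₁ x r s * covDeriv g h₂ c a b x - h₂ x r s * covDeriv g h₁ c a b x) :=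
      Bd.const_mul ((((hH hh₁ r s).mul (hD₂ c a b)).mono hp1 (by omega)).sub
        (((hH hh₂ r s).mul (hD₁ c a b)).mono hp1 (by omega))) _
    exact (hA.mul hB).mono hp1 (by omega)
  have hS : Bd p 1 fun x => Real.sqrt (-(g x).det) / (16 * Real.pi * G) := by
    refine ((hg.bd_sqrt hO hp hp1).const_mul (16 * Real.pi * G)⁻¹).congr
      (Eventually.of_forall fun x => ?_)
    simp only
    ring
  exact (hS.mul key).mono hp1 (by omega)

end

/-! ### Comparison of one-sided and two-sided derivatives for `ρ > 0` -/

lemma pd_congr {f f' : Coord n → ℝ} (h : ∀ y ∈ pos n, f y = f' y) {x : Coord n} (hx : x ∈ pos n)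
    (μ : Fin (n + 3)) : pd μ f x = pd μ f' x := by
  have : f =ᶠ[𝓝 x] f' := by
    filter_upwards [isOpen_pos.mem_nhds hx] with y hy using h y hy
  rw [pd, pd, this.fderiv_eq]

lemma lieDeriv_eq_lieW {ξ : VField n} {g g' : Tensor2 n} (h : ∀ y ∈ pos n, g y = g' y)
    {x : Coord n} (hx : x ∈ pos n) : lieDeriv ξ g x = lieW ξ g' x := by
  ext μ ν
  refine Finset.sum_congr rfl fun α _ => ?_
  rw [pd_congr (fun y hy => by rw [h y hy]) hx, h x hx, pd_eq_dW hx, pd_eq_dW hx, pd_eq_dW hx]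

lemma pullback_eq_pullW {φ : Coord n → Coord n} {g : Tensor2 n} {x : Coord n} (hx : x ∈ pos n) :
    pullback φ g x = pullW φ g x := by
  ext μ ν
  refine Finset.sum_congr rfl fun α _ => Finset.sum_congr rfl fun β _ => ?_
  rw [pd_eq_dW hx, pd_eq_dW hx]

lemma christoffel_congr {g g' : Tensor2 n} (h : ∀ y ∈ pos n, g y = g' y) {x : Coord n}
    (hx : x ∈ pos n) (α μ ν : Fin (n + 3)) : christoffel g α μ ν x = christoffel g' α μ ν x := by
  have hp : ∀ γ α β, pd γ (fun y => g y α β) x = pd γ (fun y => g' y α β) x :=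
    fun γ α β => pd_congr (fun y hy => by rw [h y hy]) hx γ
  simp only [christoffel, hp, h x hx]

lemma covDeriv_congr {g g' k k' : Tensor2 n} (h : ∀ y ∈ pos n, g y = g' y)
    (hk : ∀ y ∈ pos n, k y = k' y) {x : Coord n}
    (hx : x ∈ pos n) (γ α β : Fin (n + 3)) : covDeriv g k γ α β x = covDeriv g' k' γ α β x := by
  have hp : ∀ γ α β, pd γ (fun y => k y α β) x = pd γ (fun y => k' y α β) x :=
    fun γ α β => pd_congr (fun y hy => by rw [hk y hy]) hx γ
  simp only [covDeriv, hp, hk x hx, christoffel_congr h hx]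

lemma presymplecticCurrent_congr (G : ℝ) {g g' : Tensor2 n} (h : ∀ y ∈ pos n, g y = g' y)
    {h₁ h₂ k₁ k₂ : Tensor2 n} (hh₁ : ∀ y ∈ pos n, h₁ y = k₁ y) (hh₂ : ∀ y ∈ pos n, h₂ y = k₂ y)
    (ν : Fin (n + 3)) {x : Coord n} (hx : x ∈ pos n) :
    presymplecticCurrent G g h₁ h₂ ν x = presymplecticCurrent G g' k₁ k₂ ν x := by
  simp only [presymplecticCurrent, covDeriv_congr h hh₁ hx, covDeriv_congr h hh₂ hx, h x hx,
    hh₁ x hx, hh₂ x hx]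

/-! ### Continuity of the current for `ρ > 0` -/

section continuity
variable {O : Set (Coord n)} {x : Coord n}

lemma Sm.continuousAt {f : Coord n → ℝ} (hf : Sm O f) (hx : x ∈ O) (hx' : x ∈ pos n) :
    ContinuousAt f x :=
  (hf x hx (pos_subset_half hx')).continuousWithinAt.continuousAt (half_mem_nhds hx')

lemma Sm.continuousAt_pd {f : Coord n → ℝ} (hf : Sm O f) (hx : x ∈ O) (hx' : x ∈ pos n)
    (μ : Fin (n + 3)) : ContinuousAt (pd μ f) x := by
  refine ((hf.deriv μ).continuousAt hx hx').congr ?_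
  filter_upwards [isOpen_pos.mem_nhds hx'] with y hy
  exact (pd_eq_dW hy).symm

lemma continuousAt_covDeriv {g h : Tensor2 n} (hg : ∀ μ ν, Sm O fun y => g y μ ν)
    (hh : ∀ μ ν, Sm O fun y => h y μ ν) (hx : x ∈ O) (hx' : x ∈ pos n)
    (hI : ∀ μ ν, ContinuousAt (fun y => (g y)⁻¹ μ ν) x) (γ α β : Fin (n + 3)) :
    ContinuousAt (covDeriv g h γ α β) x := by
  have h1 := fun μ ν => (hh μ ν).continuousAt hx hx'
  have h2 := fun γ μ ν => (hh μ ν).continuousAt_pd hx hx' γ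
  have h3 := fun γ μ ν => (hg μ ν).continuousAt_pd hx hx' γ
  have h4 : ∀ α μ ν, ContinuousAt (christoffel g α μ ν) x := fun α μ ν =>
    continuousAt_const.mul (tendsto_finsetSum _ fun β _ =>
      (hI α β).mul (((h3 μ β ν).add (h3 ν β μ)).sub (h3 β μ ν)))
  exact (h2 γ α β).sub (tendsto_finsetSum _ fun δ _ =>
    ((h4 δ γ α).mul (h1 δ β)).add ((h4 δ γ β).mul (h1 α δ)))

/-- Provides the integrability over compact pieces at fixed `ρ > 0`; the bounds do not depend on it.
-/
lemma continuousAt_current (G : ℝ) {g h₁ h₂ : Tensor2 n} (hg : ∀ μ ν, Sm O fun y => g y μ ν)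
    (hh₁ : ∀ μ ν, Sm O fun y => h₁ y μ ν) (hh₂ : ∀ μ ν, Sm O fun y => h₂ y μ ν)
    (hx : x ∈ O) (hx' : x ∈ pos n) (hdet : (g x).det ≠ 0) (ν : Fin (n + 3)) :
    ContinuousAt (presymplecticCurrent G g h₁ h₂ ν) x := by
  have hgc : ContinuousAt g x := tendsto_pi_nhds.2 fun μ => tendsto_pi_nhds.2 fun ν =>
    (hg μ ν).continuousAt hx hx'
  have hI : ∀ μ ν, ContinuousAt (fun y => (g y)⁻¹ μ ν) x := fun μ ν =>
    (tendsto_pi_nhds.1 ((tendsto_pi_nhds.1 (tendsto_inv_matrix hgc hdet)) μ)) ν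
  have hd : ContinuousAt (fun y => (g y).det) x :=
    ((Continuous.matrix_det continuous_id).tendsto _).comp hgc
  have hS : ContinuousAt (fun y => Real.sqrt (-(g y).det) / (16 * Real.pi * G)) x :=
    (Real.continuous_sqrt.continuousAt.comp hd.neg).div_const _
  have h1 := fun μ ν => (hh₁ μ ν).continuousAt hx hx'
  have h2 := fun μ ν => (hh₂ μ ν).continuousAt hx hx'
  have c1 := continuousAt_covDeriv hg hh₁ hx hx' hI
  have c2 := continuousAt_covDeriv hg hh₂ hx hx' hI
  refine hS.mul (tendsto_finsetSum _ fun r _ => tendsto_finsetSum _ fun s _ =>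
    tendsto_finsetSum _ fun c _ => tendsto_finsetSum _ fun a _ => tendsto_finsetSum _ fun b _ => ?_)
  refine ContinuousAt.mul (ContinuousAt.add (ContinuousAt.add ?_ ?_) ?_) ?_
  · exact (hI ν a).mul (((hI r s).mul (hI b c)).sub ((continuousAt_const.mul (hI r b)).mul (hI s c)))
  · exact (continuousAt_const.mul (hI ν c)).mul (continuousAt_const.mul
      (((hI r a).mul (hI s b)).sub ((hI r s).mul (hI a b))))
  · exact ((hI ν r).mul (hI a b)).mul (hI s c)
  · exact continuousAt_const.mul (((h1 r s).mul (c2 c a b)).sub ((h2 r s).mul (c1 c a b)))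

end continuity

/-! ### Integrals over the cross-sections -/

lemma continuous_slicePt (t : ℝ) :
    Continuous fun q : ℝ × (Fin (n + 1) → ℝ) => slicePt t q.1 q.2 := by
  refine continuous_pi fun μ => ?_
  cases μ using index_cases with
  | h0 => exact continuous_const
  | h1 => exact continuous_fst
  | h2 M => exact (continuous_apply M).comp continuous_snd

lemma slicePt_one (t ρ : ℝ) (y : Fin (n + 1) → ℝ) : slicePt t ρ y 1 = ρ := rfl

/-- A function that is `O(ρ)` near a compact piece of the horizon has integrals over the surfaces
of constant `t` and `ρ` that tend to zero. -/
lemma tendsto_integral_slice {F : Coord n → ℝ} {t : ℝ} {K : Set (Fin (n + 1) → ℝ)}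
    (hK : IsCompact K) (hF : ∀ y ∈ K, Bd (slicePt t 0 y) 1 F)
    (hc : ∀ y ∈ K, ∀ᶠ x in 𝓝[pos n] (slicePt t 0 y), ContinuousAt F x) :
    (∀ᶠ ρ in 𝓝[>] (0 : ℝ), IntegrableOn (fun y => F (slicePt t ρ y)) K) ∧
      Tendsto (fun ρ => ∫ y in K, F (slicePt t ρ y)) (𝓝[>] (0 : ℝ)) (𝓝 0) := by
  -- Compactness turns the local bounds at points of `K` into one constant, carrying along the
  -- continuity used for integrability.
  have key : ∃ C : ℝ, ∀ᶠ ρ in 𝓝[>] (0 : ℝ), ∀ y ∈ K, ‖F (slicePt t ρ y)‖ ≤ C * ρ ∧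
      ContinuousAt F (slicePt t ρ y) := by
    refine hK.induction_on (p := fun S => ∃ C : ℝ, ∀ᶠ ρ in 𝓝[>] (0 : ℝ), ∀ y ∈ S,
      ‖F (slicePt t ρ y)‖ ≤ C * ρ ∧ ContinuousAt F (slicePt t ρ y)) ⟨0, by simp⟩ ?_ ?_ ?_
    · rintro S T hST ⟨C, h⟩
      exact ⟨C, h.mono fun ρ h y hy => h y (hST hy)⟩
    · rintro S T ⟨C, hS⟩ ⟨C', hT⟩
      refine ⟨max C C', ?_⟩
      filter_upwards [hS, hT, self_mem_nhdsWithin] with ρ h1 h2 (hρ : 0 < ρ) y hy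
      rcases hy with hy | hy
      · exact ⟨(h1 y hy).1.trans (mul_le_mul_of_nonneg_right (le_max_left _ _) hρ.le), (h1 y hy).2⟩
      · exact ⟨(h2 y hy).1.trans (mul_le_mul_of_nonneg_right (le_max_right _ _) hρ.le), (h2 y hy).2⟩
    · intro y hy
      obtain ⟨C, hC⟩ := (hF y hy).bound
      have h1 : Tendsto (fun q : ℝ × (Fin (n + 1) → ℝ) => slicePt t q.1 q.2)
          (𝓝[>] (0 : ℝ) ×ˢ 𝓝 y) (𝓝[pos n] (slicePt t 0 y)) := by
        refine tendsto_nhdsWithin_iff.2 ⟨?_, ?_⟩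
        · have := (continuous_slicePt (n := n) t).tendsto (0, y)
          rw [nhds_prod_eq] at this
          exact this.mono_left (Filter.prod_mono nhdsWithin_le_nhds le_rfl)
        · exact (tendsto_fst (f := 𝓝[>] (0 : ℝ)) (g := 𝓝 y)).eventually self_mem_nhdsWithin
      obtain ⟨P, hP, Q, hQ, h2⟩ := eventually_prod_iff.1 (h1.eventually (hC.and (hc y hy)))
      refine ⟨{y | Q y}, mem_nhdsWithin_of_mem_nhds hQ, C, ?_⟩
      filter_upwards [hP, self_mem_nhdsWithin] with ρ hρ (hρ0 : 0 < ρ) z hz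
      refine ⟨?_, (h2 hρ hz).2⟩
      simpa [slicePt_one, abs_of_pos hρ0] using (h2 hρ hz).1
  obtain ⟨C, hC⟩ := key
  refine ⟨?_, ?_⟩
  · filter_upwards [hC] with ρ h
    refine ContinuousOn.integrableOn_compact hK fun y hy => ?_
    have h1 : Continuous fun y : Fin (n + 1) → ℝ => slicePt t ρ y :=
      (continuous_slicePt t).comp (Continuous.prodMk_right ρ)
    exact (ContinuousAt.comp (g := F) (h y hy).2 h1.continuousAt).continuousWithinAt
  · have h0 : Tendsto (fun ρ : ℝ => C * ρ * (volume K).toReal) (𝓝[>] (0 : ℝ)) (𝓝 0) := by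
      have : Continuous fun ρ : ℝ => C * ρ * (volume K).toReal := by fun_prop
      have := (this.tendsto 0).mono_left (nhdsWithin_le_nhds (s := Ioi 0))
      simpa using this
    refine squeeze_zero_norm' ?_ h0
    filter_upwards [hC] with ρ h
    exact norm_setIntegral_le_of_norm_le_const hK.measure_lt_top fun y hy => (h y hy).1

/-! ### Flows -/

section ode
variable {E : Type*} [NormedAddCommGroup E] [NormedSpace ℝ E]

/-- Uniqueness for linear ordinary differential equations, forwards and backwards. -/
lemma linear_ode_unique {A : ℝ → E →L[ℝ] E} (hA : ContinuousOn A (Icc 0 1)) {u w : ℝ → E}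
    (hu : ∀ s ∈ Icc (0 : ℝ) 1, HasDerivWithinAt u (A s (u s)) (Icc 0 1) s)
    (hw : ∀ s ∈ Icc (0 : ℝ) 1, HasDerivWithinAt w (A s (w s)) (Icc 0 1) s)
    (h : u 0 = w 0 ∨ u 1 = w 1) : EqOn u w (Icc 0 1) := by
  obtain ⟨K, hK⟩ := isCompact_Icc.exists_bound_of_continuousOn hA
  have hL : ∀ s ∈ Icc (0 : ℝ) 1, LipschitzOnWith K.toNNReal (fun e => A s e) univ := fun s hs =>
    ((A s).lipschitz.weaken (NNReal.le_toNNReal_of_coe_le (hK s hs))).lipschitzOnWith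
  have huc : ContinuousOn u (Icc 0 1) := fun s hs => (hu s hs).continuousWithinAt
  have hwc : ContinuousOn w (Icc 0 1) := fun s hs => (hw s hs).continuousWithinAt
  rcases h with h | h
  · have hm : ∀ s ∈ Ico (0 : ℝ) 1, Icc (0 : ℝ) 1 ∈ 𝓝[Ici s] s := fun s hs =>
      mem_of_superset (Icc_mem_nhdsGE hs.2) (Icc_subset_Icc_left hs.1)
    exact ODE_solution_unique_of_mem_Icc_right (v := fun s e => A s e) (s := fun _ => univ)
      (fun s hs => hL s (Ico_subset_Icc_self hs)) huc
      (fun s hs => (hu s (Ico_subset_Icc_self hs)).mono_of_mem_nhdsWithin (hm s hs))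
      (fun _ _ => trivial) hwc
      (fun s hs => (hw s (Ico_subset_Icc_self hs)).mono_of_mem_nhdsWithin (hm s hs))
      (fun _ _ => trivial) h
  · have hm : ∀ s ∈ Ioc (0 : ℝ) 1, Icc (0 : ℝ) 1 ∈ 𝓝[Iic s] s := fun s hs =>
      mem_of_superset (Icc_mem_nhdsLE hs.1) (Icc_subset_Icc_right hs.2)
    exact ODE_solution_unique_of_mem_Icc_left (v := fun s e => A s e) (s := fun _ => univ)
      (fun s hs => hL s (Ioc_subset_Icc_self hs)) huc
      (fun s hs => (hu s (Ioc_subset_Icc_self hs)).mono_of_mem_nhdsWithin (hm s hs))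
      (fun _ _ => trivial) hwc
      (fun s hs => (hw s (Ioc_subset_Icc_self hs)).mono_of_mem_nhdsWithin (hm s hs))
      (fun _ _ => trivial) h

/-- The first variation of a flow solves the linearized equation. -/
lemma hasDerivWithinAt_variation {W R : Set E} (hW : UniqueDiffOn ℝ W)
    (hW' : W ⊆ closure (interior W)) {Φ : ℝ × E → E}
    (hΦ : ContDiffOn ℝ ∞ Φ (Icc (0 : ℝ) 1 ×ˢ W)) {ξ : E → E}
    (hd : ∀ x ∈ W, ∀ s ∈ Icc (0 : ℝ) 1,
      HasDerivWithinAt (fun s' => Φ (s', x)) (ξ (Φ (s, x))) (Icc 0 1) s)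
    (hm : MapsTo Φ (Icc (0 : ℝ) 1 ×ˢ W) R) (hξ : DifferentiableOn ℝ ξ R) {x : E} (hx : x ∈ W)
    (v : E) {s : ℝ} (hs : s ∈ Icc (0 : ℝ) 1) :
    HasDerivWithinAt (fun s' => fderivWithin ℝ Φ (Icc (0 : ℝ) 1 ×ˢ W) (s', x) (0, v))
      (fderivWithin ℝ ξ R (Φ (s, x)) (fderivWithin ℝ Φ (Icc (0 : ℝ) 1 ×ˢ W) (s, x) (0, v)))
      (Icc 0 1) s := by
  set S := Icc (0 : ℝ) 1 ×ˢ W with hS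
  have hSu : UniqueDiffOn ℝ S := (uniqueDiffOn_Icc one_pos).prod hW
  have hSc : S ⊆ closure (interior S) := by
    rw [hS, interior_prod_eq, closure_prod_eq, interior_Icc, closure_Ioo zero_ne_one]
    exact prod_mono Subset.rfl hW'
  have hq : (s, x) ∈ S := ⟨hs, hx⟩
  set D := fderivWithin ℝ Φ S with hD
  have hDd : DifferentiableWithinAt ℝ D S (s, x) :=
    ((hΦ (s, x) hq).fderivWithin_right (m := ∞) hSu (by simp) hq).differentiableWithinAt (by simp)
  have hsymm : IsSymmSndFDerivWithinAt ℝ Φ S (s, x) :=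
    (hΦ (s, x) hq).isSymmSndFDerivWithinAt
      (by simpa using WithTop.coe_le_coe.2 (le_top : (2 : ℕ∞) ≤ ⊤)) hSu (hSc hq) hq
  have hcurve : ∀ y ∈ W, ∀ s' ∈ Icc (0 : ℝ) 1,
      HasDerivWithinAt (fun s' : ℝ => (s', y)) ((1 : ℝ), (0 : E)) (Icc 0 1) s' := fun y _ s' _ =>
    ((hasDerivAt_id s').prodMk (hasDerivAt_const s' y)).hasDerivWithinAt
  have htime : ∀ q ∈ S, D q ((1 : ℝ), (0 : E)) = ξ (Φ q) := by
    rintro ⟨s', y⟩ ⟨hs', hy⟩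
    have h1 := (((hΦ (s', y) ⟨hs', hy⟩).differentiableWithinAt (by simp)).hasFDerivWithinAt
      ).comp_hasDerivWithinAt s' (hcurve y hy s' hs') (fun r hr => (⟨hr, hy⟩ : (r, y) ∈ S))
    exact (uniqueDiffOn_Icc one_pos s' hs').eq_deriv _ h1 (hd y hy s' hs')
  have h1 := hDd.hasFDerivWithinAt.comp_hasDerivWithinAt s (hcurve x hx s hs)
    (fun r hr => (⟨hr, hx⟩ : (r, x) ∈ S))
  have h2 := h1.clm_apply (hasDerivWithinAt_const s (Icc (0 : ℝ) 1) ((0 : ℝ), v))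
  have h3 : HasFDerivWithinAt (fun q => D q ((1 : ℝ), (0 : E)))
      ((fderivWithin ℝ ξ R (Φ (s, x))).comp (D (s, x))) S (s, x) := by
    have := ((hξ _ (hm hq)).hasFDerivWithinAt).comp (s, x)
      ((hΦ (s, x) hq).differentiableWithinAt (by simp)).hasFDerivWithinAt hm
    exact this.congr htime (htime _ hq)
  have h4 := hDd.hasFDerivWithinAt.clm_apply
    (hasFDerivWithinAt_const ((1 : ℝ), (0 : E)) (s, x) S)
  -- `h5` evaluates the derivative of `∂_s Φ = ξ ∘ Φ` in the direction `v` in two ways, and `h6`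
  -- exchanges the two slots of the second derivative, so that it becomes the time derivative of the
  -- variation.
  have h5 := congrArg (fun L => L ((0 : ℝ), v)) ((hSu _ hq).eq h4 h3)
  have h6 := hsymm ((0 : ℝ), v) ((1 : ℝ), (0 : E))
  simp only [ContinuousLinearMap.comp_zero, zero_add, ContinuousLinearMap.flip_apply,
    ContinuousLinearMap.comp_apply] at h5
  rw [map_zero, add_zero] at h2
  rw [← h5]
  exact h2.congr_deriv h6.symm

end ode

/-! ### Smooth maps of the half space and their differentials at the horizon -/

lemma uniqueDiffOn_inter_half {O : Set (Coord n)} (hO : IsOpen O) :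
    UniqueDiffOn ℝ (O ∩ half n) := by
  rw [inter_comm]
  exact uniqueDiffOn_half.inter hO

lemma inter_half_subset_closure_interior {O : Set (Coord n)} (hO : IsOpen O) :
    O ∩ half n ⊆ closure (interior (O ∩ half n)) := by
  rintro x ⟨hx, hx'⟩
  rw [interior_inter, hO.interior_eq]
  exact hO.inter_closure ⟨hx, half_subset_closure_interior hx'⟩

lemma fderivWithin_inter_half {F : Type*} [NormedAddCommGroup F] [NormedSpace ℝ F]
    {O : Set (Coord n)} (hO : IsOpen O) (f : Coord n → F) {x : Coord n} (hx : x ∈ O) :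
    fderivWithin ℝ f (O ∩ half n) x = fderivWithin ℝ f (half n) x := by
  rw [inter_comm]
  exact fderivWithin_inter (hO.mem_nhds hx)

lemma sm_pi_iff {O : Set (Coord n)} (hO : IsOpen O) {φ : Coord n → Coord n} :
    (∀ α, Sm O fun x => φ x α) ↔ ContDiffOn ℝ ∞ φ (O ∩ half n) := by
  rw [contDiffOn_pi]
  exact forall_congr' fun α => sm_iff hO

lemma differentiable_pi_half {O : Set (Coord n)} {φ : Coord n → Coord n}
    (h : ∀ α, Sm O fun x => φ x α) {x : Coord n} (hx : x ∈ O) (hx' : x ∈ half n) :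
    DifferentiableWithinAt ℝ φ (half n) x :=
  differentiableWithinAt_pi.2 fun α => (h α).diff hx hx'

lemma dW_pi {O : Set (Coord n)} {φ : Coord n → Coord n}
    (h : ∀ α, Sm O fun x => φ x α) {x : Coord n} (hx : x ∈ O) (hx' : x ∈ half n)
    (μ α : Fin (n + 3)) :
    dW μ (fun y => φ y α) x = fderivWithin ℝ φ (half n) x (Pi.single μ 1) α := by
  rw [dW, fderivWithin_apply (differentiable_pi_half h hx hx') (uniqueDiffOn_half x hx')]
  rfl

/-- Smooth maps that preserve the horizon, have an invertible derivative there, and fix the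
vectors `∂_t` and `∂_ρ` at the horizon. -/
structure Diffeo (O O' : Set (Coord n)) (φ : Coord n → Coord n) : Prop where
  sm : ∀ α, Sm O (fun x => φ x α)
  maps : ∀ x ∈ O, x ∈ half n → φ x ∈ O' ∧ φ x ∈ half n
  horizon : ∀ x ∈ O, x 1 = 0 → φ x 1 = 0
  dt : ∀ x ∈ O, x 1 = 0 → fderivWithin ℝ φ (half n) x (Pi.single 0 1) = Pi.single 0 1
  dr : ∀ x ∈ O, x 1 = 0 → fderivWithin ℝ φ (half n) x (Pi.single 1 1) = Pi.single 1 1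
  inj : ∀ x ∈ O, x 1 = 0 → Function.Injective (fderivWithin ℝ φ (half n) x)

lemma Diffeo.comp {O O' O'' : Set (Coord n)} (hO : IsOpen O)
    {φ φ' : Coord n → Coord n} (h' : Diffeo O' O'' φ') (h : Diffeo O O' φ) :
    Diffeo O O'' (φ' ∘ φ) := by
  have hD : ∀ x ∈ O, x 1 = 0 → fderivWithin ℝ (φ' ∘ φ) (half n) x =
      (fderivWithin ℝ φ' (half n) (φ x)).comp (fderivWithin ℝ φ (half n) x) := by
    intro x hx hx1
    have h1 := (differentiable_pi_half h'.sm (h.maps x hx hx1.ge).1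
      (h.maps x hx hx1.ge).2).hasFDerivWithinAt
    have h2 := (differentiable_pi_half h.sm hx hx1.ge).hasFDerivWithinAt.mono
      (inter_subset_left (t := O))
    have h3 := h1.comp x h2 (fun y hy => (h.maps y hy.2 hy.1).2)
    exact ((hasFDerivWithinAt_inter (hO.mem_nhds hx)).1 h3).fderivWithin
      (uniqueDiffOn_half x hx1.ge)
  refine ⟨fun α => Sm.comp hO h.sm h.maps (h'.sm α), fun x hx hx' => ?_, fun x hx hx1 => ?_,
    fun x hx hx1 => ?_, fun x hx hx1 => ?_, fun x hx hx1 => ?_⟩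
  · exact h'.maps _ (h.maps x hx hx').1 (h.maps x hx hx').2
  · exact h'.horizon _ (h.maps x hx hx1.ge).1 (h.horizon x hx hx1)
  · rw [hD x hx hx1, ContinuousLinearMap.comp_apply, h.dt x hx hx1,
      h'.dt _ (h.maps x hx hx1.ge).1 (h.horizon x hx hx1)]
  · rw [hD x hx hx1, ContinuousLinearMap.comp_apply, h.dr x hx hx1,
      h'.dr _ (h.maps x hx hx1.ge).1 (h.horizon x hx hx1)]
  · rw [hD x hx hx1]
    exact (h'.inj _ (h.maps x hx hx1.ge).1 (h.horizon x hx hx1)).comp (h.inj x hx hx1)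

/-- The differential fixes `∂_t` and `∂_ρ` along the whole horizon, so these first-order conditions
may be differentiated tangentially; this is what gives second-order vanishing. -/
lemma Diffeo.mapF {O O' : Set (Coord n)} (hO : IsOpen O)
    {φ : Coord n → Coord n} (h : Diffeo O O' φ) : MapF O O' φ := by
  have ht : ∀ α, ∀ x ∈ O, x 1 = 0 → dW 0 (fun y => φ y α) x = (Pi.single 0 1 : Coord n) α :=
    fun α x hx hx1 => by rw [dW_pi h.sm hx hx1.ge, h.dt x hx hx1]
  have hr : ∀ α, ∀ x ∈ O, x 1 = 0 → dW 1 (fun y => φ y α) x = (Pi.single 1 1 : Coord n) α :=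
    fun α x hx hx1 => by rw [dW_pi h.sm hx hx1.ge, h.dr x hx hx1]
  have hr1 : ∀ α, Van O 1 fun x => dW 1 (fun y => φ y α) x + -(Pi.single 1 1 : Coord n) α :=
    fun α => van_one (((h.sm α).deriv 1).add (sm_const _)) fun x hx hx1 => by
      rw [hr α x hx hx1, add_neg_cancel]
  have hrho : Van O 2 fun x => φ x 1 - x 1 := by
    simp only [sub_eq_add_neg]
    have hs : Sm O fun x : Coord n => -x 1 := van_rho.neg hO |>.sm
    refine van_two ((h.sm 1).add hs) (fun x hx hx1 => by simp [h.horizon x hx hx1, hx1])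
      fun x hx hx1 => ?_
    rw [dW_add (h.sm 1) hs 1 hx hx1.ge, hr 1 x hx hx1]
    have : (fun y : Coord n => -y 1) = fun y => -1 * y 1 := by funext y; ring
    rw [this, dW_mul (sm_const _) (sm_coord 1) 1 hx hx1.ge, dW_const, dW_coord _ _ hx1.ge]
    simp
  have hrt : ∀ μ, μ ≠ 1 → Van O 2 (dW μ fun x => φ x 1) := by
    intro μ hμ
    refine (hrho.dW_tangent hO hμ).congr hO fun x hx hx' => ?_
    have e : (fun y => φ y 1 - y 1) = fun y => φ y 1 + -1 * y 1 := by funext y; ring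
    have hs : Sm O fun x : Coord n => -1 * x 1 := (sm_const _).mul (sm_coord 1)
    rw [e, dW_add (h.sm 1) hs μ hx hx', dW_mul (sm_const _) (sm_coord 1) μ hx hx', dW_const,
      dW_coord _ _ hx', if_neg hμ.symm]
    ring
  have htt : ∀ α, α ≠ 0 → Van O 2 (dW 0 fun x => φ x α) := by
    intro α hα
    refine van_two ((h.sm α).deriv 0) (fun x hx hx1 => by rw [ht α x hx hx1]; simp [hα])
      fun x hx hx1 => ?_
    -- After the exchange, `∂_ρ φ^α` is constant along the horizon, so its `t`-derivative vanishes
    -- there.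
    rw [dW_comm (h.sm α) 1 0 hx hx1.ge]
    have := ((hr1 α).dW_tangent hO (μ := 0) (by simp)).zero_of hx hx1
    rwa [dW_add ((h.sm α).deriv 1) (sm_const _) 0 hx hx1.ge, dW_const, add_zero] at this
  have hrr : ∀ α, α ≠ 1 → Van O 1 (dW 1 fun x => φ x α) := fun α hα =>
    van_one ((h.sm α).deriv 1) fun x hx hx1 => by rw [hr α x hx hx1]; simp [hα]
  refine ⟨h.sm, h.maps, h.horizon, ?_, ?_, ?_, hrho, ?_⟩
  · intro μ α
    cases μ using index_cases with
    | h0 =>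
      cases α using index_cases with
      | h0 => exact (h.sm _).deriv _
      | h1 => exact htt _ (by simp)
      | h2 N => exact htt _ (Fin.succ_ne_zero _)
    | h1 =>
      cases α using index_cases with
      | h0 => exact hrr _ (by simp)
      | h1 => exact (h.sm _).deriv _
      | h2 N => exact hrr _ (succ_ne_one N)
    | h2 M =>
      cases α using index_cases with
      | h0 => exact (h.sm _).deriv _
      | h1 => exact hrt _ (succ_ne_one M)
      | h2 N => exact (h.sm _).deriv _
  · exact van_one (((h.sm 0).deriv 0).add (sm_const (-1))) fun x hx hx1 => by
      rw [ht 0 x hx hx1]; simp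
  · exact van_one (((h.sm 1).deriv 1).add (sm_const (-1))) fun x hx hx1 => by
      rw [hr 1 x hx hx1]; simp
  · intro p hp hp1 hdet
    obtain ⟨v, hv, h0⟩ := Matrix.exists_vecMul_eq_zero_iff.2 hdet
    set D := fderivWithin ℝ φ (half n) p with hDdef
    set u : Coord n := ∑ M, v M • (Pi.single M.succ.succ 1 : Coord n) with hu
    have hDu : ∀ α, D u α = ∑ M, v M * dW M.succ.succ (fun y => φ y α) p := by
      intro α
      rw [hu, map_sum, Finset.sum_apply]
      refine Finset.sum_congr rfl fun M _ => ?_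
      rw [map_smul, Pi.smul_apply, smul_eq_mul, dW_pi h.sm hp hp1.ge]
    -- The cross components of `D u` vanish by the choice of `v`, and the `ρ` component because `∂_M
    -- φ^ρ` vanishes on the horizon. So `D u` is a multiple of `∂_t`, which is its own image, and
    -- injectivity forces `u` to be that multiple.
    have h1 : D u = D (D u 0 • (Pi.single 0 1 : Coord n)) := by
      rw [map_smul, h.dt p hp hp1]
      funext α
      cases α using index_cases with
      | h0 => simp
      | h1 =>
        rw [hDu 1, Finset.sum_eq_zero fun M _ => by
          rw [(hrt _ (succ_ne_one M)).zero_of hp hp1, mul_zero]]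
        simp
      | h2 N =>
        rw [hDu]
        have := congrFun h0 N
        simp only [Matrix.vecMul, dotProduct, Matrix.of_apply, Pi.zero_apply] at this
        rw [this]
        simp
    have h2 := h.inj p hp hp1 h1
    refine hv (funext fun M => ?_)
    have h3 := congrFun h2 M.succ.succ
    rw [hu, Finset.sum_apply, Finset.sum_eq_single M] at h3
    · simpa using h3
    · intro N _ hN
      have : (M.succ.succ : Fin (n + 3)) ≠ N.succ.succ := fun e =>
        hN (Fin.succ_injective _ (Fin.succ_injective _ e)).symm
      simp [this]
    · simp

variable {ρ₀ : ℝ} {U : Set (Fin (n + 1) → ℝ)}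

/-! ### The coordinate domain -/

/-- The conditions `ρ < ρ₀` and `x^M ∈ U`. -/
def chart (ρ₀ : ℝ) (U : Set (Fin (n + 1) → ℝ)) : Set (Coord n) := {x | x 1 < ρ₀ ∧ crossPt x ∈ U}

lemma region_eq : region ρ₀ U = chart ρ₀ U ∩ half n := by
  ext x
  simp only [region, chart, half, mem_ofPred_eq, mem_inter_iff]
  tauto

/-- The projection to the cross-section. -/
def crossCLM (n : ℕ) : Coord n →L[ℝ] (Fin (n + 1) → ℝ) :=
  ContinuousLinearMap.pi fun M => ContinuousLinearMap.proj M.succ.succ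

lemma isOpen_chart (hU : IsOpen U) : IsOpen (chart ρ₀ U : Set (Coord n)) :=
  (isOpen_lt (continuous_apply 1) continuous_const).inter (hU.preimage (crossCLM n).continuous)

lemma mem_region_of {x : Coord n} (hx : x ∈ chart ρ₀ U) (hx' : x ∈ half n) : x ∈ region ρ₀ U :=
  region_eq ▸ ⟨hx, hx'⟩

lemma SmoothO.van (hU : IsOpen U) {k : ℕ} {f : Coord n → ℝ} (h : SmoothO ρ₀ U k f) :
    Van (chart ρ₀ U) k f := by
  obtain ⟨r, hr, hf⟩ := h
  rw [region_eq] at hr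
  have h1 := (van_rho_pow (isOpen_chart hU) (k := k)).mul (isOpen_chart hU) (l := 0)
    ((sm_iff (isOpen_chart hU)).2 hr)
  exact h1.congr (isOpen_chart hU) fun x hx hx' => hf x (mem_region_of hx hx')

lemma sm_cross (hU : IsOpen U) {A : (Fin (n + 1) → ℝ) → ℝ} (hA : ContDiffOn ℝ ∞ A U) :
    Sm (chart ρ₀ U) fun x => A (crossPt x) := fun x hx _ =>
  ((hA.contDiffAt (hU.mem_nhds hx.2)).comp x
    (crossCLM n).contDiff.contDiffAt).contDiffWithinAt

lemma hasFDerivAt_cross (hU : IsOpen U) {A : (Fin (n + 1) → ℝ) → ℝ} (hA : ContDiffOn ℝ ∞ A U)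
    {x : Coord n} (hx : crossPt x ∈ U) : HasFDerivAt (fun x => A (crossPt x))
      ((fderiv ℝ A (crossPt x)).comp (crossCLM n)) x :=
  (((hA.contDiffAt (hU.mem_nhds hx)).differentiableAt (by simp)).hasFDerivAt).comp x
    (crossCLM n).hasFDerivAt

lemma dW_cross (hU : IsOpen U) {A : (Fin (n + 1) → ℝ) → ℝ} (hA : ContDiffOn ℝ ∞ A U)
    {μ : Fin (n + 3)} (hμ : cls μ ≠ 2) {x : Coord n} (hx : x ∈ chart ρ₀ U) (hx' : x ∈ half n) :
    dW μ (fun y => A (crossPt y)) x = 0 := by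
  rw [dW, (hasFDerivAt_cross hU hA hx.2).hasFDerivWithinAt.fderivWithin (uniqueDiffOn_half x hx'),
    ContinuousLinearMap.comp_apply]
  have : crossCLM n (Pi.single μ 1) = 0 := by
    funext M
    have hM : (M.succ.succ : Fin (n + 3)) ≠ μ := fun h => hμ (h ▸ rfl)
    simp [crossCLM, hM]
  rw [this, map_zero]

/-- `A` depends on neither `t` nor `ρ`, so derivatives in these directions see only the remainder.
-/
lemma van_dW_of_sub_cross (hU : IsOpen U) {A : (Fin (n + 1) → ℝ) → ℝ} (hA : ContDiffOn ℝ ∞ A U)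
    {k : ℕ} {f : Coord n → ℝ} (hf : Van (chart ρ₀ U) k fun x => f x - A (crossPt x)) :
    Sm (chart ρ₀ U) f ∧ Van (chart ρ₀ U) k (dW 0 f) ∧ Van (chart ρ₀ U) (k - 1) (dW 1 f) := by
  have hO : IsOpen (chart ρ₀ U : Set (Coord n)) := isOpen_chart hU
  have hs := sm_cross (ρ₀ := ρ₀) hU hA
  have e : f = fun x => (f x - A (crossPt x)) + A (crossPt x) := by funext x; ring
  have hd : ∀ μ : Fin (n + 3), cls μ ≠ 2 → ∀ x ∈ chart ρ₀ U, x ∈ half n →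
      dW μ f x = dW μ (fun x => f x - A (crossPt x)) x := by
    intro μ hμ x hx hx'
    conv_lhs => rw [e]
    rw [dW_add hf.sm hs μ hx hx', dW_cross hU hA hμ hx hx', add_zero]
  refine ⟨?_, (hf.dW_tangent hO (by simp)).congr hO (hd 0 (by simp)),
    hf.dW_rho.congr hO (hd 1 (by simp))⟩
  rw [e]
  exact hf.sm.add hs

lemma HasLeading.vecF (hU : IsOpen U) {ξ : VField n} {T : (Fin (n + 1) → ℝ) → ℝ}
    {V : (Fin (n + 1) → ℝ) → Fin (n + 1) → ℝ} (h : HasLeading ρ₀ U ξ T V) :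
    VecF (chart ρ₀ U) ξ := by
  have h0 := van_dW_of_sub_cross hU h.smooth_T (h.t.van hU)
  have h1 := h.ρ.van hU
  have h2 := fun M => van_dW_of_sub_cross hU (contDiffOn_pi.1 h.smooth_V M) ((h.cross M).van hU)
  refine VecF.mk' (isOpen_chart hU) (fun α => ?_) h1 (fun α => ?_) (fun α => ?_)
  · cases α using index_cases with
    | h0 => exact h0.1
    | h1 => exact h1.sm
    | h2 M => exact (h2 M).1
  · cases α using index_cases with
    | h0 => exact h0.2.1
    | h1 => exact h1.dW_tangent (isOpen_chart hU) (by simp)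
    | h2 M => exact (h2 M).2.1
  · cases α using index_cases with
    | h0 => exact h0.2.2
    | h1 => exact h1.dW_rho
    | h2 M => exact (h2 M).2.2

/-! ### Diffeomorphisms generated by the algebra -/

lemma diffeo_id {O O' : Set (Coord n)} (h : O ⊆ O') : Diffeo O O' (id : Coord n → Coord n) := by
  have hD : ∀ x : Coord n, x 1 = 0 → fderivWithin ℝ id (half n) x = ContinuousLinearMap.id ℝ _ :=
    fun x hx1 => fderivWithin_id (uniqueDiffOn_half x hx1.ge)
  refine ⟨fun α => sm_coord α, fun x hx hx' => ⟨h hx, hx'⟩, fun _ _ h => h, fun x hx hx1 => ?_,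
    fun x hx hx1 => ?_, fun x hx hx1 => ?_⟩
  · rw [hD x hx1]; rfl
  · rw [hD x hx1]; rfl
  · rw [hD x hx1]; exact Function.injective_id

/-- Trajectories that start on the horizon stay there. -/
lemma flow_horizon {ξ : VField n} (hξ : SmoothO ρ₀ U 2 fun x => ξ x 1) {c : ℝ → Coord n}
    (hm : ∀ s ∈ Icc (0 : ℝ) 1, c s ∈ region ρ₀ U)
    (hd : ∀ s ∈ Icc (0 : ℝ) 1, HasDerivWithinAt c (ξ (c s)) (Icc 0 1) s) (h0 : c 0 1 = 0)
    {s : ℝ} (hs : s ∈ Icc (0 : ℝ) 1) : c s 1 = 0 := by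
  obtain ⟨r, hr, hξr⟩ := hξ
  have hc : ContinuousOn c (Icc 0 1) := fun s hs => (hd s hs).continuousWithinAt
  have hc1 : ContinuousOn (fun s => c s 1) (Icc 0 1) := (continuous_apply 1).comp_continuousOn hc
  -- Along the trajectory `ξ^ρ = (ρ r) ρ`. With `ρ r` regarded as a known coefficient, `ρ` solves a
  -- linear equation, as does the zero function.
  have hA : ContinuousOn (fun s => (c s 1 * r (c s)) • ContinuousLinearMap.id ℝ ℝ) (Icc 0 1) :=
    (hc1.mul (hr.continuousOn.comp hc hm)).smul continuousOn_const
  refine linear_ode_unique hA (u := fun s => c s 1) (w := fun _ => 0) (fun s hs => ?_)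
    (fun s _ => ?_) (Or.inl h0) hs
  · refine ((hasDerivWithinAt_pi.1 (hd s hs)) 1).congr_deriv ?_
    have := hξr _ (hm s hs)
    simp only at this
    rw [this]
    simp only [smul_apply, ContinuousLinearMap.id_apply, smul_eq_mul]
    ring
  · simpa using hasDerivWithinAt_const s (Icc (0 : ℝ) 1) (0 : ℝ)

/-- Everything follows from uniqueness for the linearized flow equation. At the horizon `Dξ`
annihilates `∂_t` and `∂_ρ`, so these constant vectors are the solutions with their own initial
values; uniqueness run backwards from time `1` makes the differential injective. -/
lemma IsExpOn.diffeo (hU : IsOpen U) {ξ : VField n} (hξ : ξ ∈ stsr ρ₀ U) {W : Set (Coord n)}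
    {φ : Coord n → Coord n} (h : IsExpOn ρ₀ U ξ W φ) :
    ∃ O, IsOpen O ∧ W = O ∩ half n ∧ Diffeo O (chart ρ₀ U) φ := by
  obtain ⟨⟨O₁, hO₁, rfl⟩, Φ, hΦ, hflow⟩ := h
  obtain ⟨T, V, hTV⟩ := hξ
  have hV := hTV.vecF hU
  set O := O₁ ∩ chart ρ₀ U with hOdef
  have hO : IsOpen O := hO₁.inter (isOpen_chart hU)
  have hWO : O₁ ∩ region ρ₀ U = O ∩ half n := by rw [region_eq, hOdef, inter_assoc]
  rw [hWO] at hΦ hflow ⊢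
  refine ⟨O, hO, rfl, ?_⟩
  set W := O ∩ half n with hW
  have hWu : UniqueDiffOn ℝ W := uniqueDiffOn_inter_half hO
  set S := Icc (0 : ℝ) 1 ×ˢ W with hS
  set Ψ : ℝ × Coord n → Coord n := fun p => Φ p.1 p.2 with hΨ
  have h01 : (1 : ℝ) ∈ Icc (0 : ℝ) 1 := right_mem_Icc.2 zero_le_one
  have h00 : (0 : ℝ) ∈ Icc (0 : ℝ) 1 := left_mem_Icc.2 zero_le_one
  have hmaps : MapsTo Ψ S (region ρ₀ U) := fun q hq => ((hflow q.2 hq.2).2.2 q.1 hq.1).1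
  have hVs : ∀ α, Sm (chart ρ₀ U) fun x => ξ x α := fun α => (hV.val α).sm
  have hξd : ContDiffOn ℝ ∞ ξ (region ρ₀ U) := by
    rw [region_eq]; exact (sm_pi_iff (isOpen_chart hU)).1 hVs
  -- the derivative of `Φ s`
  have hslice : ∀ s ∈ Icc (0 : ℝ) 1, ∀ x ∈ W, ∀ v, fderivWithin ℝ (Φ s) W x v =
      fderivWithin ℝ Ψ S (s, x) (0, v) := by
    intro s hs x hx v
    have h1 := ((hΦ (s, x) ⟨hs, hx⟩).differentiableWithinAt (by simp)).hasFDerivWithinAt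
    have h2 : HasFDerivWithinAt (fun y : Coord n => (s, y))
        (ContinuousLinearMap.inr ℝ ℝ (Coord n)) W x :=
      (hasFDerivAt_prodMk_right s x).hasFDerivWithinAt
    have h3 := (h1.comp x h2 (fun y hy => (⟨hs, hy⟩ : (s, y) ∈ S))).fderivWithin (hWu x hx)
    have h4 := congrArg (fun L => L v) h3
    exact h4
  have hφ : ContDiffOn ℝ ∞ φ W := by
    have h1 : ContDiffOn ℝ ∞ (fun x => Ψ (1, x)) W :=
      hΦ.comp (contDiff_prodMk_right (1 : ℝ)).contDiffOn (fun y hy => (⟨h01, hy⟩ : (1, y) ∈ S))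
    exact h1.congr fun x hx => (hflow x hx).2.1.symm
  have hφD : ∀ x ∈ W, ∀ v, fderivWithin ℝ φ (half n) x v = fderivWithin ℝ Ψ S (1, x) (0, v) := by
    intro x hx v
    rw [← hslice 1 h01 x hx v, ← fderivWithin_inter_half hO φ hx.1]
    rw [fderivWithin_congr (fun y hy => (hflow y hy).2.1.symm) (hflow x hx).2.1.symm]
  have hidD : ∀ x ∈ W, ∀ v, fderivWithin ℝ Ψ S (0, x) (0, v) = v := by
    intro x hx v
    rw [← hslice 0 h00 x hx v, fderivWithin_congr (f := id) (fun y hy => (hflow y hy).1)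
      (hflow x hx).1, fderivWithin_id (hWu x hx)]
    rfl
  have hhor : ∀ x ∈ W, x 1 = 0 → ∀ s ∈ Icc (0 : ℝ) 1, Φ s x 1 = 0 := fun x hx hx1 s hs =>
    flow_horizon hTV.ρ (c := fun s => Φ s x) (fun s hs => ((hflow x hx).2.2 s hs).1)
      (fun s hs => ((hflow x hx).2.2 s hs).2) (by rw [(hflow x hx).1, hx1]) hs
  set A : Coord n → ℝ → Coord n →L[ℝ] Coord n := fun x s =>
    fderivWithin ℝ ξ (region ρ₀ U) (Φ s x) with hA
  have hreg : UniqueDiffOn ℝ (region ρ₀ U : Set (Coord n)) := by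
    rw [region_eq]; exact uniqueDiffOn_inter_half (isOpen_chart hU)
  have hAc : ∀ x ∈ W, ContinuousOn (A x) (Icc 0 1) := fun x hx =>
    ((hξd.fderivWithin hreg (m := ∞) (by simp)).continuousOn).comp
      (fun s hs => (((hflow x hx).2.2 s hs).2).continuousWithinAt)
      fun s hs => ((hflow x hx).2.2 s hs).1
  have hvar : ∀ x ∈ W, ∀ v, ∀ s ∈ Icc (0 : ℝ) 1, HasDerivWithinAt
      (fun s' => fderivWithin ℝ Ψ S (s', x) (0, v)) (A x s (fderivWithin ℝ Ψ S (s, x) (0, v)))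
      (Icc 0 1) s := fun x hx v s hs =>
    hasDerivWithinAt_variation hWu (inter_half_subset_closure_interior hO) hΦ (ξ := ξ)
      (fun y hy s hs => ((hflow y hy).2.2 s hs).2) hmaps (hξd.differentiableOn (by simp)) hx v hs
  have hfix : ∀ μ : Fin (n + 3), cls μ ≠ 2 → ∀ x ∈ O, x 1 = 0 →
      fderivWithin ℝ φ (half n) x (Pi.single μ 1) = Pi.single μ 1 := by
    intro μ hμ x hxO hx1
    have hx : x ∈ W := ⟨hxO, hx1.ge⟩
    have hz : ∀ s ∈ Icc (0 : ℝ) 1, A x s (Pi.single μ 1) = 0 := by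
      intro s hs
      have h1 : Φ s x ∈ chart ρ₀ U ∩ half n := region_eq ▸ ((hflow x hx).2.2 s hs).1
      have h2 : A x s = fderivWithin ℝ ξ (half n) (Φ s x) := by
        simp only [hA]
        rw [region_eq, fderivWithin_inter_half (isOpen_chart hU) ξ h1.1]
      rw [h2]
      funext α
      rw [← dW_pi hVs h1.1 h1.2]
      exact ((hV.der μ α).mono (l := 1) ((show ∀ m a : Fin 3, m ≠ 2 → 1 ≤ ordDV m a by decide)
        _ _ hμ)).zero_of h1.1 (hhor x hx hx1 s hs)
    rw [hφD x hx]
    refine linear_ode_unique (hAc x hx) (hvar x hx _) (w := fun _ => Pi.single μ 1)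
      (fun s hs => ?_) (Or.inl (hidD x hx _)) h01
    rw [hz s hs]
    exact hasDerivWithinAt_const _ _ _
  refine ⟨(sm_pi_iff hO).2 hφ, fun x hx hx' => ?_, fun x hx hx1 => ?_, hfix 0 (by simp),
    hfix 1 (by simp), fun x hxO hx1 => ?_⟩
  · have := ((hflow x ⟨hx, hx'⟩).2.2 1 h01).1
    rw [(hflow x ⟨hx, hx'⟩).2.1, region_eq] at this
    exact this
  · rw [← (hflow x ⟨hx, hx1.ge⟩).2.1]
    exact hhor x ⟨hx, hx1.ge⟩ hx1 1 h01
  · have hx : x ∈ W := ⟨hxO, hx1.ge⟩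
    refine (injective_iff_map_eq_zero _).2 fun v hv => ?_
    rw [hφD x hx] at hv
    have := linear_ode_unique (hAc x hx) (hvar x hx v) (w := fun _ => 0)
      (fun s _ => by rw [map_zero]; exact hasDerivWithinAt_const _ _ _) (Or.inr hv) h00
    simpa only [hidD x hx v] using this

lemma Generated.diffeo (hU : IsOpen U) {W : Set (Coord n)} {φ : Coord n → Coord n}
    (h : Generated ρ₀ U (stsr ρ₀ U) W φ) :
    ∃ O, IsOpen O ∧ O ⊆ chart ρ₀ U ∧ W = O ∩ half n ∧ Diffeo O (chart ρ₀ U) φ := by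
  induction h with
  | refl O hO =>
    exact ⟨O ∩ chart ρ₀ U, hO.inter (isOpen_chart hU), inter_subset_right, by rw [region_eq, inter_assoc],
      diffeo_id inter_subset_right⟩
  | step W W' φ φ' ξ _ hξ hφ' hW ih =>
    obtain ⟨O, hO, hOc, rfl, h1⟩ := ih
    obtain ⟨O', hO', rfl, h2⟩ := hφ'.diffeo hU hξ
    -- The induction hypothesis gives only the chart as target of `φ`; the smaller target `O'` comes
    -- from `hW`.
    refine ⟨O, hO, hOc, rfl, h2.comp hO (O' := O') ?_⟩
    exact ⟨h1.sm, fun x hx hx' => hW ⟨hx, hx'⟩, h1.horizon, h1.dt, h1.dr, h1.inj⟩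

/-! ### The background metric -/

/-- The metric induced on the horizon cross-section. -/
def crossMetric (fψψ : (Fin n → ℝ) → ℝ) (Ω : (Fin n → ℝ) → Matrix (Fin n) (Fin n) ℝ)
    (y : Fin (n + 1) → ℝ) : Matrix (Fin (n + 1)) (Fin (n + 1)) ℝ :=
  Matrix.of (Matrix.vecCons (Matrix.vecCons (fψψ (thetaPt y)) 0)
    fun A => Matrix.vecCons 0 (Ω (thetaPt y) A))

lemma crossMetric_det {fψψ : (Fin n → ℝ) → ℝ} {Ω : (Fin n → ℝ) → Matrix (Fin n) (Fin n) ℝ}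
    {y : Fin (n + 1) → ℝ} (hf : 0 < fψψ (thetaPt y)) (hΩ : (Ω (thetaPt y)).PosDef) :
    (crossMetric fψψ Ω y).det ≠ 0 := by
  intro h
  obtain ⟨v, hv, h0⟩ := Matrix.exists_mulVec_eq_zero_iff.2 h
  have hrow : ∀ M, ∑ N, crossMetric fψψ Ω y M N * v N = 0 := fun M => congrFun h0 M
  have v0 : v 0 = 0 := by
    have := hrow 0
    rw [Fin.sum_univ_succ] at this
    simpa [crossMetric, hf.ne'] using this
  have v1 : (fun A : Fin n => v A.succ) = 0 := by
    refine Matrix.eq_zero_of_mulVec_eq_zero hΩ.det_pos.ne' (funext fun A => ?_)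
    have := hrow A.succ
    rw [Fin.sum_univ_succ, v0] at this
    simpa [crossMetric, Matrix.mulVec, dotProduct] using this
  refine hv (funext fun M => ?_)
  refine Fin.cases v0 (fun A => ?_) M
  exact congrFun v1 A

variable {Λ κ : ℝ} {ftψ : (Fin n → ℝ) → ℝ} {ftA : (Fin n → ℝ) → Fin n → ℝ}
  {fψψ : (Fin n → ℝ) → ℝ} {Ω : (Fin n → ℝ) → Matrix (Fin n) (Fin n) ℝ} {g : Tensor2 n}

/-- The prescribed expansion is stronger than the class, and the leading cross-section metric
depends only on `x^M`, so its `t`-derivative is `O(ρ)`. -/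
lemma IsBackground.metr (hU : IsOpen U) (hg : IsBackground ρ₀ U Λ κ ftψ ftA fψψ Ω g) :
    Metr κ (chart ρ₀ U) g := by
  have hO : IsOpen (chart ρ₀ U : Set (Coord n)) := isOpen_chart hU
  have hsymm : ∀ {k : ℕ} {μ ν : Fin (n + 3)}, Van (chart ρ₀ U) k (fun x => g x μ ν) →
      Van (chart ρ₀ U) k (fun x => g x ν μ) := fun h =>
    h.congr hO fun x hx hx' => ((hg.symm x (mem_region_of hx hx')).apply _ _)
  have hrho : ∀ {A : (Fin (n + 1) → ℝ) → ℝ}, ContDiffOn ℝ ∞ A U →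
      ∀ {f : Coord n → ℝ}, SmoothO ρ₀ U 4 (fun x => f x - A (crossPt x) * x 1 ^ 2) →
      Van (chart ρ₀ U) 2 f := by
    intro A hA f hf
    have h1 : Van (chart ρ₀ U) 0 fun x => A (crossPt x) := sm_cross hU hA
    refine (((hf.van hU).mono (l := 2) (by norm_num)).add hO
      (h1.mul hO (van_rho_pow hO (k := 2)))).congr hO fun x _ _ => ?_
    ring
  have htM : ∀ M : Fin (n + 1), Van (chart ρ₀ U) 2 fun x => g x 0 M.succ.succ := by
    intro M
    refine Fin.cases ?_ (fun A => ?_) M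
    · exact hrho hg.smooth_ftψ hg.tψ
    · exact hrho (hg.smooth_ftA A) (hg.tA A)
  have hrM : ∀ M : Fin (n + 1), Van (chart ρ₀ U) 1 fun x => g x 1 M.succ.succ := by
    intro M
    refine Fin.cases ?_ (fun A => ?_) M
    · exact (hg.ρψ.van hU).mono (by norm_num)
    · exact ((hg.ρA A).van hU).mono (by norm_num)
  have hψA : ∀ A : Fin n, Van (chart ρ₀ U) 2 fun x => g x 2 A.succ.succ.succ :=
    fun A => (hg.ψA A).van hU
  have hMN : ∀ M N : Fin (n + 1),
      ContDiffOn ℝ ∞ (fun y => crossMetric fψψ Ω y M N) U ∧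
      Van (chart ρ₀ U) 2 fun x => g x M.succ.succ N.succ.succ
        - crossMetric fψψ Ω (crossPt x) M N := by
    intro M N
    refine Fin.cases (Fin.cases ?_ (fun B => ?_) N) (fun A => Fin.cases ?_ (fun B => ?_) N) M
    · exact ⟨hg.smooth_fψψ, hg.ψψ.van hU⟩
    · exact ⟨contDiffOn_const, (hψA B).congr hO fun x _ _ => sub_zero _⟩
    · exact ⟨contDiffOn_const, (hsymm (hψA A)).congr hO fun x _ _ => sub_zero _⟩
    · exact ⟨hg.smooth_Ω A B, (hg.AB A B).van hU⟩
  have htt : Van (chart ρ₀ U) 4 fun x => g x 0 0 + κ ^ 2 * x 1 ^ 2 :=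
    (hg.tt.van hU).congr hO fun x _ _ => by ring
  refine Metr.mk' hO (fun α β => ?_) (htt.mono (by norm_num))
    ((hg.ρρ.van hU).mono (by norm_num)) (fun M N => ?_) fun p hp hp1 => ?_
  · cases α using index_cases with
    | h0 =>
      cases β using index_cases with
      | h0 =>
        refine ((htt.mono (l := 2) (by norm_num)).sub hO
          ((van_rho_pow hO (k := 2)).const_mul hO (κ ^ 2))).congr hO fun x _ _ => ?_
        ring
      | h1 => exact (hg.tρ.van hU).mono (show 2 ≤ 4 by norm_num)
      | h2 N => exact htM N
    | h1 =>
      cases β using index_cases with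
      | h0 => exact hsymm ((hg.tρ.van hU).mono (show 2 ≤ 4 by norm_num))
      | h1 =>
        refine (Sm.add (hg.ρρ.van hU).sm (sm_const 1)).congr hO fun x _ _ => ?_
        ring
      | h2 N => exact hrM N
    | h2 M =>
      cases β using index_cases with
      | h0 => exact hsymm (htM M)
      | h1 => exact hsymm (hrM M)
      | h2 N => exact (van_dW_of_sub_cross hU (hMN M N).1 (hMN M N).2).1
  · have h := van_dW_of_sub_cross hU (hMN M N).1 (hMN M N).2
    exact ⟨h.1, h.2.1.mono (by norm_num)⟩
  · have e : (Matrix.of fun M N : Fin (n + 1) => g p M.succ.succ N.succ.succ) =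
        crossMetric fψψ Ω (crossPt p) := by
      ext M N
      exact sub_eq_zero.1 ((hMN M N).2.zero_of hp hp1)
    rw [e]
    exact crossMetric_det (hg.fψψ_pos _ hp.2) (hg.Ω_posDef _ hp.2)

/-! ### Bounds for the integrand -/

/-- The two terms are `O(1) · O(ρ)` and `O(ρ²) · O(1)`. Agreement of `g` and `g'` on `ρ > 0` alone
allows `pullback` to be replaced by `pullW`, which is smooth up to the horizon. -/
lemma bd_integrand {O : Set (Coord n)} (hO : IsOpen O) (hκ : κ ≠ 0) (G : ℝ) {g g' : Tensor2 n}
    (hgg : ∀ x ∈ pos n, g x = g' x) (hg : Metr κ O g') {ξ η χ : VField n} (hξ : VecF O ξ)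
    (hη : VecF O η) (hχ : VecF O χ) {p : Coord n} (hp : p ∈ O) (hp1 : p 1 = 0) :
    Bd p 1 (integrand G g ξ η χ) ∧
      ∀ᶠ x in 𝓝[pos n] p, ContinuousAt (integrand G g ξ η χ) x := by
  set F : Coord n → ℝ := fun x => (1 / 2) *
    (ξ x 0 * presymplecticCurrent G g' (lieW η g') (lieW χ g') 1 x
      - ξ x 1 * presymplecticCurrent G g' (lieW η g') (lieW χ g') 0 x) with hF
  have hη' := hg.lieW hO hη
  have hχ' := hg.lieW hO hχ
  have e : ∀ x ∈ pos n, integrand G g ξ η χ x = F x := by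
    intro x hx
    have h1 := fun ν => presymplecticCurrent_congr G hgg (ν := ν)
      (fun y hy => lieDeriv_eq_lieW (ξ := η) hgg hy)
      (fun y hy => lieDeriv_eq_lieW (ξ := χ) hgg hy) (x := x) hx
    simp only [integrand, hF, h1]
  constructor
  · refine Bd.congr (f := F) ?_ (by filter_upwards [self_mem_nhdsWithin] with x hx using e x hx)
    have h0 := ((hξ.val 0).bd hO hp hp1).mul (hg.bd_current hO hκ hp hp1 G hη' hχ' 1)
    have h1 := ((hξ.val 1).bd hO hp hp1).mul (hg.bd_current hO hκ hp hp1 G hη' hχ' 0)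
    exact ((h0.mono hp1 (show (1 : ℤ) ≤ (ordV 0 : ℕ) + (1 - wt 1) by decide)).sub
      (h1.mono hp1 (show (1 : ℤ) ≤ (ordV 1 : ℕ) + (1 - wt 0) by decide))).const_mul _
  · filter_upwards [self_mem_nhdsWithin, mem_nhdsWithin_of_mem_nhds (hO.mem_nhds hp),
      hg.eventually_det hO hκ hp hp1] with x hx hxO hdet
    have hc := continuousAt_current G (fun μ ν => (hg.ord μ ν).sm) (fun μ ν => (hη'.ord μ ν).sm)
      (fun μ ν => (hχ'.ord μ ν).sm) hxO hx hdet
    have hcF : ContinuousAt F x := continuousAt_const.mul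
      ((((hξ.val 0).sm.continuousAt hxO hx).mul (hc 1)).sub
        (((hξ.val 1).sm.continuousAt hxO hx).mul (hc 0)))
    refine hcF.congr ?_
    filter_upwards [isOpen_pos.mem_nhds hx] with y hy
    exact (e y hy).symm

lemma stsr_vecF (hU : IsOpen U) {ξ : VField n} (h : ξ ∈ stsr ρ₀ U) : VecF (chart ρ₀ U) ξ := by
  obtain ⟨T, V, h⟩ := h
  exact h.vecF hU

lemma VecF.subset {O O' : Set (Coord n)} {ξ : VField n} (h : VecF O ξ) (hO : O' ⊆ O) :
    VecF O' ξ :=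
  ⟨fun α => (h.val α).subset hO, fun μ α => (h.der μ α).subset hO⟩

lemma chargesIntegrable (hU : IsOpen U) (hκ : κ ≠ 0) (G : ℝ)
    (hg : IsBackground ρ₀ U Λ κ ftψ ftA fψψ Ω g) :
    ChargesIntegrable G ρ₀ U g (stsr ρ₀ U) := by
  intro W φ hφ ξ hξ η hη χ hχ t K hK hKW
  obtain ⟨O, hO, hOc, rfl, hd⟩ := hφ.diffeo hU
  have hm := (hg.metr hU).pullW hO (isOpen_chart hU) (hd.mapF hO)
  have hv : ∀ {ζ : VField n}, ζ ∈ stsr ρ₀ U → VecF O ζ := fun h => (stsr_vecF hU h).subset hOc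
  have key : ∀ y ∈ K, _ := fun y hy => bd_integrand hO hκ G (g := pullback φ g)
    (fun x hx => pullback_eq_pullW hx) hm (hv hξ) (hv hη) (hv hχ) (hKW y hy).1
    (slicePt_one t 0 y)
  exact tendsto_integral_slice hK (fun y hy => (key y hy).1) fun y hy => (key y hy).2

lemma Bd.horizonBigO {k : ℕ} {f : Coord n → ℝ}
    (h : ∀ p ∈ chart ρ₀ U, p 1 = 0 → Bd p k f) : HorizonBigO ρ₀ U k f := by
  rintro p ⟨hp, hp1⟩
  have := Asymptotics.IsBigO.mono (h p ⟨hp.2.1, hp.2.2⟩ hp1) (nhdsWithin_mono p (fun x hx => hx.2) :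
    𝓝[exterior ρ₀ U] p ≤ 𝓝[pos n] p)
  simpa only [zpow_natCast] using this

lemma sufficientCondition (hU : IsOpen U) (hκ : κ ≠ 0) (G : ℝ)
    (hg : IsBackground ρ₀ U Λ κ ftψ ftA fψψ Ω g) :
    SufficientCondition G ρ₀ U g (stsr ρ₀ U) := by
  have hO : IsOpen (chart ρ₀ U : Set (Coord n)) := isOpen_chart hU
  have hm := hg.metr hU
  refine ⟨fun ξ hξ => ?_, fun η hη χ hχ => ?_⟩
  · have h := stsr_vecF hU hξ
    refine ⟨Bd.horizonBigO fun p hp hp1 => ?_, Bd.horizonBigO fun p hp hp1 => ?_,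
      fun M => Bd.horizonBigO fun p hp hp1 => ?_⟩
    · exact (h.val 0).bd hO hp hp1
    · exact ((h.val 1).bd hO hp hp1).mono hp1 (show (1 : ℤ) ≤ (ordV 1 : ℕ) by decide)
    · exact (h.val _).bd hO hp hp1
  · have key : ∀ ν, ∀ p ∈ chart ρ₀ U, p 1 = 0 → Bd p (1 - wt (cls ν))
        (presymplecticCurrent G g (lieDeriv η g) (lieDeriv χ g) ν) := by
      intro ν p hp hp1
      refine (hm.bd_current hO hκ hp hp1 G (hm.lieW hO (stsr_vecF hU hη))
        (hm.lieW hO (stsr_vecF hU hχ)) ν).congr ?_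
      filter_upwards [self_mem_nhdsWithin] with x hx
      exact presymplecticCurrent_congr G (fun _ _ => rfl)
        (fun y hy => lieDeriv_eq_lieW (fun _ _ => rfl) hy)
        (fun y hy => lieDeriv_eq_lieW (fun _ _ => rfl) hy) ν hx
    refine ⟨Bd.horizonBigO fun p hp hp1 => (key 0 p hp hp1).mono hp1 (show (0 : ℤ) ≤ 1 - wt 0 by decide),
      Bd.horizonBigO fun p hp hp1 => (key 1 p hp hp1).mono hp1 (show (1 : ℤ) ≤ 1 - wt 1 by decide),
      fun M => Bd.horizonBigO fun p hp hp1 => (key _ p hp hp1).mono hp1 ?_⟩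
    rw [cls_succ]; decide

/-! ### The algebra -/

section algebra

variable {f h : Coord n → ℝ} {k : ℕ}

lemma SmoothO.congr (hf : SmoothO ρ₀ U k f) (hh : ∀ x ∈ region ρ₀ U, h x = f x) :
    SmoothO ρ₀ U k h := by
  obtain ⟨r, hr, hfr⟩ := hf
  exact ⟨r, hr, fun x hx => (hh x hx).trans (hfr x hx)⟩

lemma SmoothO.add (hf : SmoothO ρ₀ U k f) (hh : SmoothO ρ₀ U k h) :
    SmoothO ρ₀ U k fun x => f x + h x := by
  obtain ⟨r, hr, hfr⟩ := hf
  obtain ⟨s, hs, hhs⟩ := hh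
  exact ⟨fun x => r x + s x, hr.add hs, fun x hx => by beta_reduce; rw [hfr x hx, hhs x hx]; ring⟩

lemma SmoothO.mul_left (hf : SmoothO ρ₀ U k f) (hh : ContDiffOn ℝ ∞ h (region ρ₀ U)) :
    SmoothO ρ₀ U k fun x => h x * f x := by
  obtain ⟨r, hr, hfr⟩ := hf
  exact ⟨fun x => h x * r x, hh.mul hr, fun x hx => by beta_reduce; rw [hfr x hx]; ring⟩

lemma SmoothO.const_mul (hf : SmoothO ρ₀ U k f) (c : ℝ) : SmoothO ρ₀ U k fun x => c * f x :=
  hf.mul_left contDiffOn_const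

lemma SmoothO.sub (hf : SmoothO ρ₀ U k f) (hh : SmoothO ρ₀ U k h) :
    SmoothO ρ₀ U k fun x => f x - h x :=
  (hf.add (hh.const_mul (-1))).congr fun x _ => by ring

lemma smoothO_zero : SmoothO ρ₀ U k fun _ => 0 :=
  ⟨fun _ => 0, contDiffOn_const, fun x _ => by simp⟩

end algebra

lemma stsr_linear : (0 : VField n) ∈ stsr ρ₀ U ∧
    (∀ ξ ∈ stsr ρ₀ U, ∀ η ∈ stsr ρ₀ U, ξ + η ∈ stsr (n := n) ρ₀ U) ∧
    ∀ c : ℝ, ∀ ξ ∈ stsr ρ₀ U, c • ξ ∈ stsr (n := n) ρ₀ U := by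
  refine ⟨⟨0, 0, contDiffOn_const, contDiffOn_const, ?_, ?_, fun M => ?_⟩, ?_, ?_⟩
  · exact smoothO_zero.congr fun x _ => by simp
  · exact smoothO_zero.congr fun x _ => by simp
  · exact smoothO_zero.congr fun x _ => by simp
  · rintro ξ ⟨T₁, V₁, h₁⟩ η ⟨T₂, V₂, h₂⟩
    refine ⟨T₁ + T₂, V₁ + V₂, h₁.smooth_T.add h₂.smooth_T, h₁.smooth_V.add h₂.smooth_V,
      ?_, ?_, fun M => ?_⟩
    · exact (h₁.t.add h₂.t).congr fun x _ => by simp only [Pi.add_apply]; ring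
    · exact (h₁.ρ.add h₂.ρ).congr fun x _ => by simp only [Pi.add_apply]
    · exact ((h₁.cross M).add (h₂.cross M)).congr fun x _ => by simp only [Pi.add_apply]; ring
  · rintro c ξ ⟨T, V, h⟩
    refine ⟨c • T, c • V, h.smooth_T.const_smul c, h.smooth_V.const_smul c, ?_, ?_, fun M => ?_⟩
    · exact (h.t.const_mul c).congr fun x _ => by simp only [Pi.smul_apply, smul_eq_mul]; ring
    · exact (h.ρ.const_mul c).congr fun x _ => by simp only [Pi.smul_apply, smul_eq_mul]
    · exact ((h.cross M).const_mul c).congr fun x _ => by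
        simp only [Pi.smul_apply, smul_eq_mul]; ring

lemma uniqueDiffOn_region (hU : IsOpen U) : UniqueDiffOn ℝ (region ρ₀ U : Set (Coord n)) := by
  rw [region_eq]; exact uniqueDiffOn_inter_half (isOpen_chart hU)

/-- The derivative of `A(x^M) + O(ρ²)` along a vector field of the algebra. -/
lemma HasLeading.directional (hU : IsOpen U) {ξ : VField n} {T : (Fin (n + 1) → ℝ) → ℝ}
    {V : (Fin (n + 1) → ℝ) → Fin (n + 1) → ℝ} (h : HasLeading ρ₀ U ξ T V)
    {A : (Fin (n + 1) → ℝ) → ℝ} (hA : ContDiffOn ℝ ∞ A U) {f : Coord n → ℝ}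
    (hf : SmoothO ρ₀ U 2 fun x => f x - A (crossPt x)) :
    SmoothO ρ₀ U 2 fun x => fderivWithin ℝ f (region ρ₀ U) x (ξ x)
      - fderiv ℝ A (crossPt x) (V (crossPt x)) := by
  have hreg := uniqueDiffOn_region (ρ₀ := ρ₀) hU
  have hξs : ContDiffOn ℝ ∞ ξ (region ρ₀ U) := by
    rw [region_eq]
    exact (sm_pi_iff (isOpen_chart hU)).1 fun α => ((h.vecF hU).val α).sm
  obtain ⟨r, hr, hfr⟩ := hf
  obtain ⟨q, hq, hξq⟩ := h.ρ
  choose s hs hξs' using h.cross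
  have hcr : ContDiffOn ℝ ∞ (crossPt : Coord n → _) (region ρ₀ U) :=
    (crossCLM n).contDiff.contDiffOn
  have hmU : MapsTo (crossPt : Coord n → _) (region ρ₀ U) U := fun x hx => hx.2.2
  -- Expand the derivative of `A + ρ² r` along `ξ^M = V^M + ρ² s^M`, `ξ^ρ = ρ² q`, and divide what
  -- is left after `dA(V)` by `ρ²`: this gives `dA(s) + 2 ρ q r + dr(ξ)`, smooth up to the horizon.
  refine ⟨fun x => fderiv ℝ A (crossPt x) (fun M => s M x) + 2 * x 1 * q x * r x
    + fderivWithin ℝ r (region ρ₀ U) x (ξ x), ?_, fun x hx => ?_⟩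
  · have h1 : ContDiffOn ℝ ∞ (fun x : Coord n => fderiv ℝ A (crossPt x)) (region ρ₀ U) :=
      (hA.fderiv_of_isOpen hU (by simp)).comp hcr hmU
    have h2 : ContDiffOn ℝ ∞ (fun x => fun M => s M x) (region ρ₀ U) := contDiffOn_pi.2 hs
    have h3 : ContDiffOn ℝ ∞ (fun x : Coord n => x 1) (region ρ₀ U) :=
      (contDiff_apply ℝ ℝ 1).contDiffOn
    exact ((h1.clm_apply h2).add (((contDiffOn_const.mul h3).mul hq).mul hr)).add
      ((hr.fderivWithin hreg (by simp)).clm_apply hξs)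
  · have e : ∀ y ∈ region ρ₀ U, f y = A (crossPt y) + y 1 ^ 2 * r y := fun y hy => by
      rw [← hfr y hy]; ring
    have hp : HasFDerivWithinAt (fun y : Coord n => y 1)
        (ContinuousLinearMap.proj (R := ℝ) (φ := fun _ => ℝ) 1) (region ρ₀ U) x :=
      (ContinuousLinearMap.proj (R := ℝ) (φ := fun _ => ℝ) 1).hasFDerivWithinAt
    have hd := ((hasFDerivAt_cross hU hA hx.2.2).hasFDerivWithinAt (s := region ρ₀ U)).add
      ((hp.pow 2).mul ((hr x hx).differentiableWithinAt (by simp)).hasFDerivWithinAt)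
    have hd' : HasFDerivWithinAt f _ (region ρ₀ U) x := hd.congr e (e x hx)
    beta_reduce
    rw [hd'.fderivWithin (hreg x hx)]
    have hV : crossCLM n (ξ x) = V (crossPt x) + x 1 ^ 2 • (fun M => s M x) := by
      funext M
      have := hξs' M x hx
      simp only [Pi.add_apply, Pi.smul_apply, smul_eq_mul]
      rw [← this]
      exact (add_sub_cancel _ _).symm
    have hρ := hξq x hx
    simp only at hρ
    simp only [add_apply, smul_apply, ContinuousLinearMap.comp_apply, hV, map_add, map_smul,
      smul_eq_mul, ContinuousLinearMap.proj_apply, hρ]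
    simp
    ring

lemma HasLeading.lieBracket (hU : IsOpen U) {ξ η : VField n} {T₁ T₂ : (Fin (n + 1) → ℝ) → ℝ}
    {V₁ V₂ : (Fin (n + 1) → ℝ) → Fin (n + 1) → ℝ} (hξ : HasLeading ρ₀ U ξ T₁ V₁)
    (hη : HasLeading ρ₀ U η T₂ V₂) :
    HasLeading ρ₀ U (VectorField.lieBracketWithin ℝ ξ η (region ρ₀ U))
      (fun y => fderiv ℝ T₂ y (V₁ y) - fderiv ℝ T₁ y (V₂ y))
      (fun y => fderiv ℝ V₂ y (V₁ y) - fderiv ℝ V₁ y (V₂ y)) := by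
  have hreg := uniqueDiffOn_region (ρ₀ := ρ₀) hU
  have hcomp : ∀ {ζ : VField n}, VecF (chart ρ₀ U) ζ → ∀ α, ∀ x ∈ region ρ₀ U, ∀ v,
      fderivWithin ℝ ζ (region ρ₀ U) x v α
        = fderivWithin ℝ (fun y => ζ y α) (region ρ₀ U) x v := by
    intro ζ hζ α x hx v
    have hs : ContDiffOn ℝ ∞ ζ (region ρ₀ U) := by
      rw [region_eq]
      exact (sm_pi_iff (isOpen_chart hU)).1 fun α => (hζ.val α).sm
    rw [fderivWithin_apply ((hs x hx).differentiableWithinAt (by simp)) (hreg x hx)]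
    rfl
  have hbr : ∀ α, ∀ x ∈ region ρ₀ U, VectorField.lieBracketWithin ℝ ξ η (region ρ₀ U) x α
      = fderivWithin ℝ (fun y => η y α) (region ρ₀ U) x (ξ x)
        - fderivWithin ℝ (fun y => ξ y α) (region ρ₀ U) x (η x) := by
    intro α x hx
    rw [← hcomp (hη.vecF hU) α x hx, ← hcomp (hξ.vecF hU) α x hx]
    rfl
  have hTV : ∀ {F : Type} [NormedAddCommGroup F] [NormedSpace ℝ F] {A : (Fin (n + 1) → ℝ) → F}
      {V : (Fin (n + 1) → ℝ) → Fin (n + 1) → ℝ}, ContDiffOn ℝ ∞ A U → ContDiffOn ℝ ∞ V U →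
      ContDiffOn ℝ ∞ (fun y => fderiv ℝ A y (V y)) U := fun hA hV =>
    (hA.fderiv_of_isOpen hU (by simp)).clm_apply hV
  have hM : ∀ {V V' : (Fin (n + 1) → ℝ) → Fin (n + 1) → ℝ}, ContDiffOn ℝ ∞ V U → ∀ M,
      ∀ y ∈ U, fderiv ℝ V y (V' y) M = fderiv ℝ (fun y => V y M) y (V' y) := by
    intro V V' hV M y hy
    rw [fderiv_apply ((hV.contDiffAt (hU.mem_nhds hy)).differentiableAt (by simp))]
    rfl
  refine ⟨(hTV hη.smooth_T hξ.smooth_V).sub (hTV hξ.smooth_T hη.smooth_V),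
    (hTV hη.smooth_V hξ.smooth_V).sub (hTV hξ.smooth_V hη.smooth_V), ?_, ?_, fun M => ?_⟩
  · refine ((hξ.directional hU hη.smooth_T hη.t).sub
      (hη.directional hU hξ.smooth_T hξ.t)).congr fun x hx => ?_
    rw [hbr 0 x hx]
    ring
  -- The `ρ` component is the case of leading coefficient zero.
  · have h0 : ContDiffOn ℝ ∞ (fun _ : Fin (n + 1) → ℝ => (0 : ℝ)) U := contDiffOn_const
    refine ((hξ.directional hU h0 (f := fun y => η y 1) (by simpa using hη.ρ)).sub
      (hη.directional hU h0 (f := fun y => ξ y 1) (by simpa using hξ.ρ))).congr fun x hx => ?_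
    rw [hbr 1 x hx]
    simp
  · refine ((hξ.directional hU (contDiffOn_pi.1 hη.smooth_V M) (hη.cross M)).sub
      (hη.directional hU (contDiffOn_pi.1 hξ.smooth_V M) (hξ.cross M))).congr fun x hx => ?_
    rw [hbr _ x hx, Pi.sub_apply, hM hη.smooth_V M _ hx.2.2, hM hξ.smooth_V M _ hx.2.2]
    ring

end KillingHorizon

end

theorem mainTheorem4 (n : ℕ) (G Λ κ ρ₀ : ℝ) (hG : 0 < G) (hκ : κ ≠ 0) (hρ₀ : 0 < ρ₀)
    (U : Set (Fin (n + 1) → ℝ)) (hU : IsOpen U)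
    (ftψ : (Fin n → ℝ) → ℝ) (ftA : (Fin n → ℝ) → Fin n → ℝ) (fψψ : (Fin n → ℝ) → ℝ)
    (Ω : (Fin n → ℝ) → Matrix (Fin n) (Fin n) ℝ) (g : KillingHorizon.Tensor2 n)
    (hg : KillingHorizon.IsBackground ρ₀ U Λ κ ftψ ftA fψψ Ω g) :
    (∀ (ξ η : KillingHorizon.VField n) (T₁ T₂ : (Fin (n + 1) → ℝ) → ℝ)
      (V₁ V₂ : (Fin (n + 1) → ℝ) → Fin (n + 1) → ℝ),
      KillingHorizon.HasLeading ρ₀ U ξ T₁ V₁ → KillingHorizon.HasLeading ρ₀ U η T₂ V₂ →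
      KillingHorizon.HasLeading ρ₀ U
        (VectorField.lieBracketWithin ℝ ξ η (KillingHorizon.region ρ₀ U))
        (fun y => fderiv ℝ T₂ y (V₁ y) - fderiv ℝ T₁ y (V₂ y))
        (fun y => fderiv ℝ V₂ y (V₁ y) - fderiv ℝ V₁ y (V₂ y))) ∧
    KillingHorizon.IsClosedAlgebra ρ₀ U (KillingHorizon.stsr ρ₀ U) ∧
    KillingHorizon.SufficientCondition G ρ₀ U g (KillingHorizon.stsr ρ₀ U) ∧
    KillingHorizon.ChargesIntegrable G ρ₀ U g (KillingHorizon.stsr ρ₀ U) := by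
  refine ⟨fun ξ η T₁ T₂ V₁ V₂ hξ hη => hξ.lieBracket hU hη, ?_,
    KillingHorizon.sufficientCondition hU hκ G hg, KillingHorizon.chargesIntegrable hU hκ G hg⟩
  refine ⟨KillingHorizon.stsr_linear.1, KillingHorizon.stsr_linear.2.1,
    KillingHorizon.stsr_linear.2.2, ?_⟩
  rintro ξ ⟨T₁, V₁, hξ⟩ η ⟨T₂, V₂, hη⟩
  exact ⟨_, _, hξ.lieBracket hU hη⟩
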